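/- Let $M$ be a smooth finite-dimensional manifold (Hausdorff, second countable, without boundary) and let $U\subset\mathbb R\times TM$ be open. A (time-dependent) Lagrangian is a continuous function $L:U\to\mathbb R$ such that, for each $t$, $L(t,\cdot)$ is of class $C^1$ on $U_t=\{v\in TM:(t,v)\in U\}$, its differential $(t,v)\mapsto \mathrm d(L(t,\cdot))(v)$ is continuous on $U$, and, for each $t$, the fiber derivative $\mathbb FL(t,\cdot):U_t\to TM^*$, $\mathbb FL(t,v)=\mathrm d\big(L(t,\cdot)|_{U_t\cap T_mM}\big)(v)\in T_mM^*$ for $v\in T_mM$, is of class $C^1$. $L$ is hyper-regular if, for all $t\in\mathbb R$ and $m\in M$, $\mathbb FL(t,\cdot)$ restricted to $U_t\cap T_mM$ is a ($C^1$) diffeomorphism onto an open subset of $T_mM^*$. In this case let $V=\{(t,\mathbb FL(t,v)):(t,v)\in U\}\subset\mathbb R\times TM^*$ and let the Legendre transform $H=L^*:V\to\mathbb R$ be given by $H(t,\mathbb FL(t,v))=\mathbb FL(t,v)\,v-L(t,v)$ for $(t,v)\in U$. Let $a<b$, let $P,Q\subset M$ be smooth embedded submanifolds, and let $\Omega_{PQ}([a,b],M;U)$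 be the Banach manifold of the $C^1$ curves $\gamma:[a,b]\to M$ with $\gamma(a)\in P$, $\gamma(b)\in Q$ and $(t,\dot\gamma(t))\in U$ for all $t\in[a,b]$. On it consider the action functional $\mathcal L(\gamma)=\int_a^bL(t,\dot\gamma(t))\,\mathrm dt$. A curve $\gamma$ is a critical point of $\mathcal L$ if $\mathrm d\mathcal L(\gamma)=0$, that is, if $\frac{\mathrm d}{\mathrm ds}\big|_{s=0}\mathcal L(\gamma_s)=0$ for every $C^1$ curve $s\mapsto\gamma_s$, $s\in(-\varepsilon,\varepsilon)$, in $\Omega_{PQ}([a,b],M;U)$ with $\gamma_0=\gamma$; here $s\mapsto\gamma_s$ is of class $C^1$ if $\dot\gamma_s(t)\in TM$ is differentiable in $s$ and the derivative $\partial_s\dot\gamma_s(t)\in T(TM)$ is continuous in $(s,t)$. Let $\omega=-\mathrm d\vartheta$ be the canonical symplectic form of $TM^*$, where $\vartheta_p(\zeta)=p(\mathrm d\pi_p(\zeta))$ and $\pi:TM^*\to M$ is the projection, and let $\vec H$ be given by $\omega(\vec H(t,p),\cdot)=\mathrm d\big(H(t,\cdot)\big)(p)$ for $(t,p)\in V$.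 A Hamiltonian lift of a curve $\gamma:[a,b]\to M$ is a $C^1$ curve $\Gamma:[a,b]\to TM^*$ with $\pi\circ\Gamma=\gamma$, $(t,\Gamma(t))\in V$ and $\frac{\mathrm d}{\mathrm dt}\Gamma(t)=\vec H(t,\Gamma(t))$ for all $t\in[a,b]$; $\gamma$ is a solution of the Hamiltonian $H$ if it has such a lift. Theorem. Let $L$ be a hyper-regular Lagrangian on $M$, $H=L^*$, and let $P$, $Q$ be smooth embedded submanifolds of $M$. A curve $\gamma\in\Omega_{PQ}([a,b],M;U)$ is a critical point of $\mathcal L$ if and only if $\gamma$ is a solution of the Hamiltonian $H$ which admits a Hamiltonian lift $\Gamma$ such that $$\Gamma(a)|_{T_{\gamma(a)}P}=0,\qquad \Gamma(b)|_{T_{\gamma(b)}Q}=0.$$ -/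

import Mathlib

open Set Bundle
open scoped Manifold ContDiff Topology

noncomputable section

namespace LagrangeHamilton

section Cotangent

variable {E : Type*} [NormedAddCommGroup E] [NormedSpace ℝ E]
  {H : Type*} [TopologicalSpace H] (I : ModelWithCorners ℝ E H)
  (M : Type*) [TopologicalSpace M] [ChartedSpace H M]

/-- The cotangent bundle of a manifold: the fibre over `x` is the dual of the tangent space at
`x`.  Its topology and its atlas are those of Mathlib's bundles of continuous linear maps. -/
abbrev CotangentBundle : Type _ :=
  TotalSpace (E →L[ℝ] ℝ) (fun x : M => TangentSpace I x →L[ℝ] Trivial M ℝ x)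

variable {M}

/-- The differential at `x` of a real valued function, as a point of the cotangent bundle. -/
def differential (f : M → ℝ) (x : M) : CotangentBundle I M :=
  ⟨x, (mfderiv I 𝓘(ℝ, ℝ) f x : E →L[ℝ] ℝ)⟩

/-- The exterior derivative at `x` of a `1`-form `α` on a manifold, evaluated on two tangent
vectors: `α` is pulled back to the model vector space by the inverse of the chart at `x`, and there
`dα(u, v) = D_u (α v) - D_v (α u)` for constant vector fields `u`, `v`. -/
def extDerivOneForm (α : ∀ x : M, TangentSpace I x →L[ℝ] ℝ) (x : M)
    (u v : TangentSpace I x) : ℝ :=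
  let β : E → E →L[ℝ] ℝ := fun y =>
    (α ((extChartAt I x).symm y)).comp
      (mfderivWithin 𝓘(ℝ, E) I (extChartAt I x).symm (range I) y)
  let y : E := extChartAt I x x
  let D : E →L[ℝ] E →L[ℝ] ℝ := fderivWithin ℝ β (range I) y
  let u' : E := mfderiv I 𝓘(ℝ, E) (extChartAt I x) x u
  let v' : E := mfderiv I 𝓘(ℝ, E) (extChartAt I x) x v
  D u' v' - D v' u'

end Cotangent

variable {E : Type*} [NormedAddCommGroup E] [NormedSpace ℝ E]
  {M : Type*} [TopologicalSpace M] [ChartedSpace E M] [IsManifold 𝓘(ℝ, E) ∞ M]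

/-! ### Lagrangians, the fibre derivative and the Legendre transform -/

/-- The slice `{v ∈ TM : (t, v) ∈ U}` of `U ⊆ ℝ × TM`. -/
def slice (U : Set (ℝ × TangentBundle 𝓘(ℝ, E) M)) (t : ℝ) : Set (TangentBundle 𝓘(ℝ, E) M) :=
  {v | (t, v) ∈ U}

/-- The part of `U ⊆ ℝ × TM` in the fibre `{t} × T_m M`. -/
def fiber (U : Set (ℝ × TangentBundle 𝓘(ℝ, E) M)) (t : ℝ) (m : M) : Set E :=
  {w | (t, (⟨m, w⟩ : TangentBundle 𝓘(ℝ, E) M)) ∈ U}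

/-- The derivative of `L` along the fibre `{t} × T_m M`, as a map from `T_m M` to its dual. -/
def fiberDeriv (L : ℝ × TangentBundle 𝓘(ℝ, E) M → ℝ) (t : ℝ) (m : M) (w : E) : E →L[ℝ] ℝ :=
  fderiv ℝ (fun w' : E => L (t, ⟨m, w'⟩)) w

/-- The fibre derivative `𝔽L(t, ·) : TM → TM^*`. -/
def FL (L : ℝ × TangentBundle 𝓘(ℝ, E) M → ℝ) (t : ℝ) (v : TangentBundle 𝓘(ℝ, E) M) :
    CotangentBundle 𝓘(ℝ, E) M :=
  ⟨v.proj, fiberDeriv (E := E) L t v.proj v.2⟩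

/-- `L : U ⊆ ℝ × TM → ℝ` is a time-dependent Lagrangian; only the values of `L` on `U` matter. -/
structure IsLagrangian (U : Set (ℝ × TangentBundle 𝓘(ℝ, E) M))
    (L : ℝ × TangentBundle 𝓘(ℝ, E) M → ℝ) : Prop where
  isOpen : IsOpen U
  continuousOn : ContinuousOn L U
  contMDiffOn : ∀ t, ContMDiffOn (𝓘(ℝ, E).tangent) 𝓘(ℝ, ℝ) 1 (fun v => L (t, v)) (slice U t)
  continuousOn_differential :
    ContinuousOn (fun x : ℝ × TangentBundle 𝓘(ℝ, E) M =>
      differential 𝓘(ℝ, E).tangent (fun v => L (x.1, v)) x.2) U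
  contMDiffOn_FL : ∀ t, ContMDiffOn (𝓘(ℝ, E).tangent) (𝓘(ℝ, E).prod 𝓘(ℝ, E →L[ℝ] ℝ)) 1
    (FL L t) (slice U t)

/-- `F` maps `A` diffeomorphically (in the class `C¹`) onto an open set. -/
def IsDiffeoOntoOpen {X Y : Type*} [NormedAddCommGroup X] [NormedSpace ℝ X]
    [NormedAddCommGroup Y] [NormedSpace ℝ Y] (F : X → Y) (A : Set X) : Prop :=
  IsOpen (F '' A) ∧ ContDiffOn ℝ 1 F A ∧
    ∃ G : Y → X, ContDiffOn ℝ 1 G (F '' A) ∧ ∀ w ∈ A, G (F w) = w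

/-- `L` is hyper-regular: on every fibre `{t} × T_m M`, its fibre derivative is a diffeomorphism
onto an open subset of the dual. -/
def IsHyperRegular (U : Set (ℝ × TangentBundle 𝓘(ℝ, E) M))
    (L : ℝ × TangentBundle 𝓘(ℝ, E) M → ℝ) : Prop :=
  ∀ t m, IsDiffeoOntoOpen (fiberDeriv L t m) (fiber U t m)

/-- The image `V = 𝔽L(U) ⊆ ℝ × TM^*`, the domain of the Legendre transform. -/
def imageFL (U : Set (ℝ × TangentBundle 𝓘(ℝ, E) M))
    (L : ℝ × TangentBundle 𝓘(ℝ, E) M → ℝ) : Set (ℝ × CotangentBundle 𝓘(ℝ, E) M) :=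
  (fun x : ℝ × TangentBundle 𝓘(ℝ, E) M => (x.1, FL L x.1 x.2)) '' U

/-- The Legendre transform `L^* = E_L ∘ 𝔽L⁻¹`, where `E_L(v) = 𝔽L(v) v - L(v)`.  Its values
are meaningful on `imageFL U L` only. -/
def legendre (U : Set (ℝ × TangentBundle 𝓘(ℝ, E) M))
    (L : ℝ × TangentBundle 𝓘(ℝ, E) M → ℝ) (x : ℝ × CotangentBundle 𝓘(ℝ, E) M) : ℝ :=
  let p : E →L[ℝ] ℝ := x.2.2
  let w : E := Function.invFunOn (fiberDeriv L x.1 x.2.proj) (fiber U x.1 x.2.proj) p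
  p w - L (x.1, ⟨x.2.proj, w⟩)

/-! ### Embedded submanifolds -/

/-- `P` is a smooth embedded submanifold of `M`: around each of its points there is a chart of the
smooth structure in which `P` is a piece of an affine subspace. -/
def IsEmbeddedSubmanifold (P : Set M) : Prop :=
  ∀ x ∈ P, ∃ φ ∈ IsManifold.maximalAtlas 𝓘(ℝ, E) ∞ M, x ∈ φ.source ∧
    ∃ F : Submodule ℝ E, ∀ y ∈ φ.source, y ∈ P ↔ φ y - φ x ∈ F

/-- `v ∈ T_x M` is tangent to `P`: it is the velocity at time `0` of a `C¹` curve in `P`. -/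
def IsTangentTo (P : Set M) (x : M) (v : TangentSpace 𝓘(ℝ, E) x) : Prop :=
  ∃ c : ℝ → M, c 0 = x ∧ (∀ᶠ s in 𝓝 0, c s ∈ P) ∧ ContMDiffAt 𝓘(ℝ, ℝ) 𝓘(ℝ, E) 1 c 0 ∧
    (mfderiv 𝓘(ℝ, ℝ) 𝓘(ℝ, E) c 0 (1 : ℝ) : E) = v

/-- The covector `p` vanishes on the vectors tangent to `P` at its base point. -/
def Annihilates (p : CotangentBundle 𝓘(ℝ, E) M) (P : Set M) : Prop :=
  ∀ v : TangentSpace 𝓘(ℝ, E) p.proj, IsTangentTo P p.proj v → (p.2 v : ℝ) = 0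

/-! ### The action functional and its critical points -/

/-- The velocity `γ̇(t) ∈ TM` of a curve on `[a, b]`, one-sided at the end points. -/
def velocity (a b : ℝ) (γ : ℝ → M) (t : ℝ) : TangentBundle 𝓘(ℝ, E) M :=
  ⟨γ t, (mfderivWithin 𝓘(ℝ, ℝ) 𝓘(ℝ, E) γ (Icc a b) t (1 : ℝ) : E)⟩

/-- Membership in `Ω_{PQ}([a, b], M; U)`; only the values of `γ` on `[a, b]` matter. -/
structure IsAdmissible (U : Set (ℝ × TangentBundle 𝓘(ℝ, E) M)) (P Q : Set M) (a b : ℝ)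
    (γ : ℝ → M) : Prop where
  contMDiffOn : ContMDiffOn 𝓘(ℝ, ℝ) 𝓘(ℝ, E) 1 γ (Icc a b)
  start_mem : γ a ∈ P
  end_mem : γ b ∈ Q
  velocity_mem : ∀ t ∈ Icc a b, (t, velocity a b γ t) ∈ U

/-- The action of `L` on a curve. -/
def action (L : ℝ × TangentBundle 𝓘(ℝ, E) M → ℝ) (a b : ℝ) (γ : ℝ → M) : ℝ :=
  ∫ t in a..b, L (t, velocity a b γ t)

/-- `s ↦ c s`, `-ε < s < ε`, is a `C¹` curve in the Banach manifold `Ω_{PQ}([a, b], M; U)` that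
passes through `γ` at `s = 0`.  Since the topology and the differentiable structure of the space of
`C¹` curves are those of uniform convergence of `γ̇`, this says that the velocity
`ċ_s(t) ∈ TM` is differentiable in `s` and that its `s`-derivative, an element of `T(TM)`, is
continuous in `(s, t)` (this includes the continuity of `ċ_s(t)` in `(s, t)`). -/
structure IsVariation (U : Set (ℝ × TangentBundle 𝓘(ℝ, E) M)) (P Q : Set M) (a b : ℝ)
    (γ : ℝ → M) (ε : ℝ) (c : ℝ → ℝ → M) : Prop where
  base : ∀ t ∈ Icc a b, c 0 t = γ t
  admissible : ∀ s ∈ Ioo (-ε) ε, IsAdmissible U P Q a b (c s)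
  mdifferentiableAt : ∀ s ∈ Ioo (-ε) ε, ∀ t ∈ Icc a b,
    MDifferentiableAt 𝓘(ℝ, ℝ) 𝓘(ℝ, E).tangent (fun s' => velocity (E := E) a b (c s') t) s
  continuousOn_deriv :
    ContinuousOn (fun x : ℝ × ℝ =>
      (⟨velocity (E := E) a b (c x.1) x.2,
        (mfderiv 𝓘(ℝ, ℝ) 𝓘(ℝ, E).tangent (fun s' => velocity (E := E) a b (c s') x.2) x.1 (1 : ℝ) : E × E)⟩ :
        TangentBundle 𝓘(ℝ, E).tangent (TangentBundle 𝓘(ℝ, E) M)))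
      (Ioo (-ε) ε ×ˢ Icc a b)

/-- `γ` is a critical point of the action functional on `Ω_{PQ}([a, b], M; U)`: the differential
of the action at `γ` vanishes on the velocity at `γ` of every `C¹` curve in
`Ω_{PQ}([a, b], M; U)` through `γ` (every tangent vector at `γ` is such a velocity). -/
def IsCriticalPoint (U : Set (ℝ × TangentBundle 𝓘(ℝ, E) M))
    (L : ℝ × TangentBundle 𝓘(ℝ, E) M → ℝ) (P Q : Set M) (a b : ℝ) (γ : ℝ → M) : Prop :=
  IsAdmissible U P Q a b γ ∧
    ∀ ε > 0, ∀ c : ℝ → ℝ → M, IsVariation U P Q a b γ ε c →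
      HasDerivAt (fun s => action L a b (c s)) 0 0

/-! ### The canonical symplectic form and the Hamilton equations -/

/-- The canonical `1`-form `ϑ_p(ζ) = p(dπ_p(ζ))` on `TM^*`. -/
def canonicalForm (p : CotangentBundle 𝓘(ℝ, E) M) :
    TangentSpace (𝓘(ℝ, E).prod 𝓘(ℝ, E →L[ℝ] ℝ)) p →L[ℝ] ℝ :=
  (p.2 : TangentSpace 𝓘(ℝ, E) p.proj →L[ℝ] ℝ).comp
    (mfderiv (𝓘(ℝ, E).prod 𝓘(ℝ, E →L[ℝ] ℝ)) 𝓘(ℝ, E)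
      (fun q : CotangentBundle 𝓘(ℝ, E) M => q.proj) p)

/-- The canonical symplectic form `ω = -dϑ` on `TM^*`. -/
def symplecticForm (p : CotangentBundle 𝓘(ℝ, E) M)
    (ζ η : TangentSpace (𝓘(ℝ, E).prod 𝓘(ℝ, E →L[ℝ] ℝ)) p) : ℝ :=
  -extDerivOneForm (𝓘(ℝ, E).prod 𝓘(ℝ, E →L[ℝ] ℝ)) canonicalForm p ζ η

/-- `ζ ∈ T_p TM^*` is the value at `(t, p)` of the Hamiltonian vector field of `H`:
`ω(ζ, ·) = dH_t(p)`, where `H_t = H(t, ·)`. -/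
def IsHamiltonianVector (H : ℝ × CotangentBundle 𝓘(ℝ, E) M → ℝ) (t : ℝ)
    (p : CotangentBundle 𝓘(ℝ, E) M)
    (ζ : TangentSpace (𝓘(ℝ, E).prod 𝓘(ℝ, E →L[ℝ] ℝ)) p) : Prop :=
  MDifferentiableAt (𝓘(ℝ, E).prod 𝓘(ℝ, E →L[ℝ] ℝ)) 𝓘(ℝ, ℝ) (fun q => H (t, q)) p ∧
  ∀ η : TangentSpace (𝓘(ℝ, E).prod 𝓘(ℝ, E →L[ℝ] ℝ)) p,
    symplecticForm p ζ η =
      (mfderiv (𝓘(ℝ, E).prod 𝓘(ℝ, E →L[ℝ] ℝ)) 𝓘(ℝ, ℝ) (fun q => H (t, q)) p η : ℝ)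

/-- `Γ : [a, b] → TM^*` is a Hamiltonian lift of `γ` for the Hamiltonian `H : V → ℝ`: it is of
class `C¹`, it lies over `γ`, and `Γ̇(t) = H⃗(t, Γ(t))` on `[a, b]`. -/
structure IsHamiltonianLift (V : Set (ℝ × CotangentBundle 𝓘(ℝ, E) M))
    (H : ℝ × CotangentBundle 𝓘(ℝ, E) M → ℝ) (a b : ℝ) (γ : ℝ → M)
    (Γ : ℝ → CotangentBundle 𝓘(ℝ, E) M) : Prop where
  contMDiffOn : ContMDiffOn 𝓘(ℝ, ℝ) (𝓘(ℝ, E).prod 𝓘(ℝ, E →L[ℝ] ℝ)) 1 Γ (Icc a b)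
  proj_eq : ∀ t ∈ Icc a b, (Γ t).proj = γ t
  mem : ∀ t ∈ Icc a b, (t, Γ t) ∈ V
  hamilton : ∀ t ∈ Icc a b, IsHamiltonianVector H t (Γ t)
    (mfderivWithin 𝓘(ℝ, ℝ) (𝓘(ℝ, E).prod 𝓘(ℝ, E →L[ℝ] ℝ)) Γ (Icc a b) t (1 : ℝ))

end LagrangeHamilton

end

/-! A chart `φ` of `M` induces coordinates `(q, w)` on `TM` and `(q, p)` on `TM^*`. If `ℓ` is `L` in
these coordinates, then `FL` becomes `p = ∂ℓ/∂w` (`IsLagrangian.cotangentCoord_FL`), the canonical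
form becomes `ϑ = p dq`, and `ω(ζ, η) = η.2 ζ.1 - ζ.2 η.1` (`symplecticForm_apply`). Differentiating
`H = p w - ℓ(q, w)`, the terms in `dw` cancel because `p = ∂ℓ/∂w`, so `dH = w dp - ∂ℓ/∂q dq`
(`hasMFDerivAt_legendre`). Hence the Hamiltonian vector at `FL L t ⟨m, w⟩` is `(w, ∂ℓ/∂q)`
(`isHamiltonianVector_FL_iff`).

A Hamiltonian lift is therefore the same thing as a solution of the Euler-Lagrange equations. A lift
lies in the image of `FL`; the first Hamilton equation says that it is `FL` of the velocity of `γ`,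
and the second is `p' = ∂ℓ/∂q`.

If the Euler-Lagrange equations hold and `ξ` is the variation field of `s ↦ c s`, the pairing `p(ξ)`
has the `t`-derivative `∂ℓ/∂q ξ + ∂ℓ/∂w ξ'`, which is the integrand in the derivative of the action
(`IsVariation.hasDerivWithinAt_pairing`). Both quantities are independent of charts, so integration
over `[a, b]` leaves only the boundary terms `p(ξ)` at `b` and at `a`. The conditions on `Γ(a)` and
`Γ(b)` make them vanish, since `ξ(a)` and `ξ(b)` are tangent to `P` and `Q`.

Conversely, a critical point is tested on displacements `s η` in a single chart
(`exists_isVariation_chartVariation`). Displacements with compact support in time give the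
Euler-Lagrange equations by the lemma of du Bois-Reymond; this requires no differentiability of `p`
in advance, which matters because `FL` is only continuous in `t`. Displacements that move one end
point along `P` or `Q`, in a chart that flattens the submanifold, then give the boundary conditions.
-/

set_option linter.unusedSectionVars false

noncomputable section

namespace LagrangeHamilton

/-! ### Charts of the tangent bundle -/

section

variable {E : Type*} [NormedAddCommGroup E] [NormedSpace ℝ E]
  {M : Type*} [TopologicalSpace M] [ChartedSpace E M] [IsManifold 𝓘(ℝ, E) ∞ M]

/-- The parametrization of `TM` over the domain of a chart `φ` that is induced by `φ⁻¹`. -/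
def tangentParam (φ : OpenPartialHomeomorph M E) (z : E × E) : TangentBundle 𝓘(ℝ, E) M :=
  ⟨φ.symm z.1, (mfderiv 𝓘(ℝ, E) 𝓘(ℝ, E) φ.symm z.1 z.2 : E)⟩

/-- The coordinates on `TM` over the domain of a chart `φ` that are induced by `φ`. -/
def tangentCoord (φ : OpenPartialHomeomorph M E) (v : TangentBundle 𝓘(ℝ, E) M) : E × E :=
  (φ v.proj, (mfderiv 𝓘(ℝ, E) 𝓘(ℝ, E) φ v.proj v.2 : E))

variable {φ : OpenPartialHomeomorph M E}

theorem mdifferentiable_of_mem_maximalAtlas (hφ : φ ∈ IsManifold.maximalAtlas 𝓘(ℝ, E) ∞ M) :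
    φ.MDifferentiable 𝓘(ℝ, E) 𝓘(ℝ, E) :=
  ⟨(contMDiffOn_of_mem_maximalAtlas hφ).mdifferentiableOn (by simp),
    (contMDiffOn_symm_of_mem_maximalAtlas hφ).mdifferentiableOn (by simp)⟩

theorem tangentParam_tangentCoord (hφ : φ ∈ IsManifold.maximalAtlas 𝓘(ℝ, E) ∞ M)
    {v : TangentBundle 𝓘(ℝ, E) M} (hv : v.proj ∈ φ.source) :
    tangentParam φ (tangentCoord φ v) = v := by
  obtain ⟨m, w⟩ := v
  have h := DFunLike.congr_fun
    ((mdifferentiable_of_mem_maximalAtlas hφ).symm_comp_deriv hv) w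
  have h' : (⟨φ.symm (φ m), (mfderiv 𝓘(ℝ, E) 𝓘(ℝ, E) φ.symm (φ m)
      (mfderiv 𝓘(ℝ, E) 𝓘(ℝ, E) φ m w) : E)⟩ : TangentBundle 𝓘(ℝ, E) M) = ⟨m, w⟩ := by
    refine TotalSpace.ext (φ.left_inv hv) ?_
    exact heq_of_eq h
  exact h'

theorem tangentCoord_tangentParam (hφ : φ ∈ IsManifold.maximalAtlas 𝓘(ℝ, E) ∞ M)
    {z : E × E} (hz : z.1 ∈ φ.target) :
    tangentCoord φ (tangentParam φ z) = z := by
  have h := DFunLike.congr_fun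
    ((mdifferentiable_of_mem_maximalAtlas hφ).comp_symm_deriv hz) z.2
  refine Prod.ext (φ.right_inv hz) ?_
  exact h

theorem contMDiffOn_tangentParam (hφ : φ ∈ IsManifold.maximalAtlas 𝓘(ℝ, E) ∞ M) :
    ContMDiffOn 𝓘(ℝ, E × E) 𝓘(ℝ, E).tangent ∞ (tangentParam φ) (φ.target ×ˢ univ) := by
  have h1 : ContMDiffOn 𝓘(ℝ, E).tangent 𝓘(ℝ, E).tangent ∞
      (tangentMapWithin 𝓘(ℝ, E) 𝓘(ℝ, E) φ.symm φ.target)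
      (TotalSpace.proj ⁻¹' φ.target) :=
    (contMDiffOn_symm_of_mem_maximalAtlas hφ).contMDiffOn_tangentMapWithin (by simp)
      φ.open_target.uniqueMDiffOn
  have h2 : ContMDiff 𝓘(ℝ, E × E) 𝓘(ℝ, E).tangent ∞
      (fun z : E × E => (⟨z.1, z.2⟩ : TangentBundle 𝓘(ℝ, E) E)) := by
    rw [modelWithCornersSelf_prod]
    exact contMDiff_tangentBundleModelSpaceHomeomorph_symm
  refine (h1.comp h2.contMDiffOn (fun z hz => hz.1)).congr ?_
  intro z hz
  have : mfderivWithin 𝓘(ℝ, E) 𝓘(ℝ, E) φ.symm φ.target z.1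
      = mfderiv 𝓘(ℝ, E) 𝓘(ℝ, E) φ.symm z.1 := mfderivWithin_of_isOpen φ.open_target hz.1
  simp only [Function.comp, tangentMapWithin, tangentParam, this]

theorem contMDiffOn_tangentCoord (hφ : φ ∈ IsManifold.maximalAtlas 𝓘(ℝ, E) ∞ M) :
    ContMDiffOn 𝓘(ℝ, E).tangent 𝓘(ℝ, E × E) ∞ (tangentCoord φ)
      (TotalSpace.proj ⁻¹' φ.source) := by
  have h1 : ContMDiffOn 𝓘(ℝ, E).tangent 𝓘(ℝ, E).tangent ∞
      (tangentMapWithin 𝓘(ℝ, E) 𝓘(ℝ, E) φ φ.source)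
      (TotalSpace.proj ⁻¹' φ.source) :=
    (contMDiffOn_of_mem_maximalAtlas hφ).contMDiffOn_tangentMapWithin (by simp)
      φ.open_source.uniqueMDiffOn
  have h2 : ContMDiff 𝓘(ℝ, E).tangent 𝓘(ℝ, E × E) ∞
      (fun v : TangentBundle 𝓘(ℝ, E) E => ((v.proj, v.2) : E × E)) := by
    rw [modelWithCornersSelf_prod]
    exact contMDiff_tangentBundleModelSpaceHomeomorph
  refine (h2.comp_contMDiffOn h1).congr ?_
  intro v hv
  have : mfderivWithin 𝓘(ℝ, E) 𝓘(ℝ, E) φ φ.source v.proj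
      = mfderiv 𝓘(ℝ, E) 𝓘(ℝ, E) φ v.proj := mfderivWithin_of_isOpen φ.open_source hv
  simp only [Function.comp, tangentMapWithin, tangentCoord, this]

end

/-! ### Lagrangians in coordinates -/

section

variable {E : Type*} [NormedAddCommGroup E] [NormedSpace ℝ E]
  {M : Type*} [TopologicalSpace M] [ChartedSpace E M] [IsManifold 𝓘(ℝ, E) ∞ M]
  {φ : OpenPartialHomeomorph M E}

theorem isOpen_preimage_tangentParam (hφ : φ ∈ IsManifold.maximalAtlas 𝓘(ℝ, E) ∞ M)
    {U : Set (ℝ × TangentBundle 𝓘(ℝ, E) M)} (hU : IsOpen U) :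
    IsOpen {x : ℝ × E × E | x.2.1 ∈ φ.target ∧ (x.1, tangentParam φ x.2) ∈ U} := by
  have h : ContinuousOn (fun x : ℝ × E × E => (x.1, tangentParam φ x.2))
      {x : ℝ × E × E | x.2.1 ∈ φ.target} :=
    continuousOn_fst.prodMk ((contMDiffOn_tangentParam hφ).continuousOn.comp
      continuousOn_snd fun x hx => ⟨hx, mem_univ _⟩)
  exact h.isOpen_inter_preimage
    (φ.open_target.preimage (continuous_fst.comp continuous_snd)) hU

theorem hasDerivWithinAt_chart_comp (hφ : φ ∈ IsManifold.maximalAtlas 𝓘(ℝ, E) ∞ M)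
    {a b t : ℝ} {γ : ℝ → M}
    (hγ : MDifferentiableWithinAt 𝓘(ℝ, ℝ) 𝓘(ℝ, E) γ (Icc a b) t) (ht : γ t ∈ φ.source) :
    HasDerivWithinAt (φ ∘ γ) (tangentCoord φ (velocity (E := E) a b γ t)).2 (Icc a b) t := by
  have h := ((mdifferentiable_of_mem_maximalAtlas hφ).mdifferentiableAt ht).hasMFDerivAt.comp_hasMFDerivWithinAt
    t hγ.hasMFDerivWithinAt
  have h' : HasFDerivWithinAt (φ ∘ γ) ((mfderiv 𝓘(ℝ, E) 𝓘(ℝ, E) φ (γ t) : E →L[ℝ] E).comp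
      (mfderivWithin 𝓘(ℝ, ℝ) 𝓘(ℝ, E) γ (Icc a b) t : ℝ →L[ℝ] E)) (Icc a b) t :=
    hasMFDerivWithinAt_iff_hasFDerivWithinAt.1 h
  -- Tangent spaces are `E` only after unfolding; arbitrary `A` and `B` let the evaluation at `1`
  -- take place in `E` itself.
  have key : ∀ (A : E →L[ℝ] E) (B : ℝ →L[ℝ] E), HasFDerivWithinAt (φ ∘ γ) (A.comp B) (Icc a b) t →
      HasDerivWithinAt (φ ∘ γ) (A (B 1)) (Icc a b) t := fun A B h => h.hasDerivWithinAt
  exact key _ _ h'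

theorem velocity_congr {a b t : ℝ} {γ γ' : ℝ → M} (h : γ =ᶠ[𝓝[Icc a b] t] γ') (ht : t ∈ Icc a b) :
    velocity (E := E) a b γ t = velocity a b γ' t := by
  have h0 : γ t = γ' t := h.self_of_nhdsWithin ht
  have h1 := h.mfderivWithin_eq (I := 𝓘(ℝ, ℝ)) (I' := 𝓘(ℝ, E)) h0
  have h2 : (mfderivWithin 𝓘(ℝ, ℝ) 𝓘(ℝ, E) γ (Icc a b) t : ℝ →L[ℝ] E) =
    mfderivWithin 𝓘(ℝ, ℝ) 𝓘(ℝ, E) γ' (Icc a b) t := h1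
  exact TotalSpace.ext h0 (heq_of_eq (DFunLike.congr_fun h2 1))

theorem velocity_chart_symm_comp (hφ : φ ∈ IsManifold.maximalAtlas 𝓘(ℝ, E) ∞ M)
    {a b t : ℝ} (hab : a < b) (ht : t ∈ Icc a b) {x : ℝ → E} {w : E}
    (hx : HasDerivWithinAt x w (Icc a b) t) (hxt : x t ∈ φ.target) :
    velocity (E := E) a b (φ.symm ∘ x) t = tangentParam φ (x t, w) := by
  have h := ((mdifferentiable_of_mem_maximalAtlas hφ).mdifferentiableAt_symm hxt).hasMFDerivAt.comp_hasMFDerivWithinAt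
    t (hasMFDerivWithinAt_iff_hasFDerivWithinAt.2 hx.hasFDerivWithinAt)
  have h2 := h.mfderivWithin ((uniqueDiffOn_Icc hab t ht).uniqueMDiffWithinAt)
  refine TotalSpace.ext rfl (heq_of_eq ?_)
  have h3 := DFunLike.congr_fun h2 (1 : ℝ)
  refine h3.trans ?_
  change (mfderiv 𝓘(ℝ, E) 𝓘(ℝ, E) φ.symm (x t)) ((1 : ℝ) • w : E) = mfderiv 𝓘(ℝ, E) 𝓘(ℝ, E) φ.symm (x t) w
  rw [one_smul]

/-- The expression of a Lagrangian in the coordinates of `TM` induced by a chart `φ`. -/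
def coordLagrangian (φ : OpenPartialHomeomorph M E) (L : ℝ × TangentBundle 𝓘(ℝ, E) M → ℝ)
    (t : ℝ) (z : E × E) : ℝ := L (t, tangentParam φ z)

variable {U : Set (ℝ × TangentBundle 𝓘(ℝ, E) M)} {L : ℝ × TangentBundle 𝓘(ℝ, E) M → ℝ}

theorem IsLagrangian.isOpen_slice (hL : IsLagrangian U L) (t : ℝ) : IsOpen (slice U t) :=
  hL.isOpen.preimage (by fun_prop : Continuous fun v : TangentBundle 𝓘(ℝ, E) M => (t, v))

theorem IsLagrangian.mdifferentiableAt (hL : IsLagrangian U L) {t : ℝ}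
    {v : TangentBundle 𝓘(ℝ, E) M} (hv : (t, v) ∈ U) :
    MDifferentiableAt 𝓘(ℝ, E).tangent 𝓘(ℝ, ℝ) (fun v => L (t, v)) v :=
  ((hL.contMDiffOn t).contMDiffAt ((hL.isOpen_slice t).mem_nhds hv)).mdifferentiableAt (by simp)

theorem mdifferentiableAt_tangentParam (hφ : φ ∈ IsManifold.maximalAtlas 𝓘(ℝ, E) ∞ M)
    {z : E × E} (hz : z.1 ∈ φ.target) :
    MDifferentiableAt 𝓘(ℝ, E × E) 𝓘(ℝ, E).tangent (tangentParam φ) z :=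
  ((contMDiffOn_tangentParam hφ).contMDiffAt
    ((φ.open_target.prod isOpen_univ).mem_nhds ⟨hz, mem_univ _⟩)).mdifferentiableAt (by simp)

theorem mdifferentiableAt_tangentCoord (hφ : φ ∈ IsManifold.maximalAtlas 𝓘(ℝ, E) ∞ M)
    {v : TangentBundle 𝓘(ℝ, E) M} (hv : v.proj ∈ φ.source) :
    MDifferentiableAt 𝓘(ℝ, E).tangent 𝓘(ℝ, E × E) (tangentCoord φ) v :=
  ((contMDiffOn_tangentCoord hφ).contMDiffAt
    ((φ.open_source.preimage (FiberBundle.continuous_proj _ _)).mem_nhds hv)).mdifferentiableAt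
      (by simp)

/-- The differential of `L(t, ·)` at a point of `TM`, as a linear form on `T_v(TM)`. -/
def dL (L : ℝ × TangentBundle 𝓘(ℝ, E) M → ℝ) (t : ℝ) (v : TangentBundle 𝓘(ℝ, E) M) :
    TangentSpace 𝓘(ℝ, E).tangent v →L[ℝ] ℝ :=
  mfderiv 𝓘(ℝ, E).tangent 𝓘(ℝ, ℝ) (fun v => L (t, v)) v

theorem IsLagrangian.differentiableAt_coordLagrangian (hL : IsLagrangian U L)
    (hφ : φ ∈ IsManifold.maximalAtlas 𝓘(ℝ, E) ∞ M) {t : ℝ} {z : E × E}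
    (hz : z.1 ∈ φ.target) (hU : (t, tangentParam φ z) ∈ U) :
    DifferentiableAt ℝ (coordLagrangian φ L t) z :=
  mdifferentiableAt_iff_differentiableAt.1
    ((hL.mdifferentiableAt hU).comp z (mdifferentiableAt_tangentParam hφ hz))

theorem IsLagrangian.fderiv_coordLagrangian_apply (hL : IsLagrangian U L)
    (hφ : φ ∈ IsManifold.maximalAtlas 𝓘(ℝ, E) ∞ M) {t : ℝ} {z : E × E}
    (hz : z.1 ∈ φ.target) (hU : (t, tangentParam φ z) ∈ U) (e : E × E) :
    fderiv ℝ (coordLagrangian φ L t) z e = dL L t (tangentParam φ z)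
      (mfderiv 𝓘(ℝ, E × E) 𝓘(ℝ, E).tangent (tangentParam φ) z e) := by
  have h := mfderiv_comp z (hL.mdifferentiableAt hU) (mdifferentiableAt_tangentParam hφ hz)
  have h' : (fderiv ℝ (coordLagrangian φ L t) z : E × E →L[ℝ] ℝ) =
      (dL L t (tangentParam φ z)).comp
        (mfderiv 𝓘(ℝ, E × E) 𝓘(ℝ, E).tangent (tangentParam φ) z) := by
    rw [← mfderiv_eq_fderiv]; exact h
  exact DFunLike.congr_fun h' e

/-- A continuous family of covectors on `TM` is paired with a continuous family of vectors in
`T(TM)`. Arguing in the bundles gives joint continuity, including in the time, without choosing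
charts. -/
theorem IsLagrangian.continuousOn_dL_apply (hL : IsLagrangian U L) {X : Type*}
    [TopologicalSpace X] {s : Set X} {τ : X → ℝ} {v : X → TangentBundle 𝓘(ℝ, E) M} {ζ : X → E × E}
    (hτ : ContinuousOn τ s)
    (hv : ContinuousOn (fun x => (⟨v x, ζ x⟩ :
      TangentBundle 𝓘(ℝ, E).tangent (TangentBundle 𝓘(ℝ, E) M))) s)
    (hU : ∀ x ∈ s, (τ x, v x) ∈ U) :
    ContinuousOn (fun x => (dL L (τ x) (v x) (ζ x) : ℝ)) s := by
  have hv' : ContinuousOn v s := (FiberBundle.continuous_proj (E × E) _).comp_continuousOn hv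
  have h1 : ContinuousOn (fun x => differential 𝓘(ℝ, E).tangent (fun w => L (τ x, w)) (v x)) s :=
    hL.continuousOn_differential.comp (hτ.prodMk hv') hU
  have h2 := ContinuousOn.clm_bundle_apply (𝕜 := ℝ) (F₁ := E × E) (F₂ := ℝ)
    (E₁ := fun v : TangentBundle 𝓘(ℝ, E) M => TangentSpace 𝓘(ℝ, E).tangent v)
    (E₂ := Trivial (TangentBundle 𝓘(ℝ, E) M) ℝ) (b := v)
    (ϕ := fun x => dL L (τ x) (v x)) (v := ζ) (s := s) h1 hv
  intro x hx
  exact ((FiberBundle.continuousWithinAt_totalSpace ℝ _).1 (h2 x hx)).2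

theorem continuousOn_mfderiv_tangentParam (hφ : φ ∈ IsManifold.maximalAtlas 𝓘(ℝ, E) ∞ M)
    {X : Type*} [TopologicalSpace X] {s : Set X} {z e : X → E × E} (hz : ContinuousOn z s)
    (he : ContinuousOn e s) (hzt : ∀ x ∈ s, (z x).1 ∈ φ.target) :
    ContinuousOn (fun x => (⟨tangentParam φ (z x),
      (mfderiv 𝓘(ℝ, E × E) 𝓘(ℝ, E).tangent (tangentParam φ) (z x) (e x) : E × E)⟩ :
      TangentBundle 𝓘(ℝ, E).tangent (TangentBundle 𝓘(ℝ, E) M))) s := by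
  have h := (contMDiffOn_tangentParam hφ).continuousOn_tangentMapWithin (by simp)
    (φ.open_target.prod isOpen_univ).uniqueMDiffOn
  have h2 : ContinuousOn (fun x => (⟨z x, e x⟩ : TangentBundle 𝓘(ℝ, E × E) (E × E))) s :=
    (tangentBundleModelSpaceHomeomorph 𝓘(ℝ, E × E)).symm.continuous.comp_continuousOn
      (hz.prodMk he)
  refine (h.comp h2 fun x hx => ⟨hzt x hx, mem_univ _⟩).congr ?_
  intro x hx
  have : mfderivWithin 𝓘(ℝ, E × E) 𝓘(ℝ, E).tangent (tangentParam φ) (φ.target ×ˢ univ) (z x)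
    = mfderiv 𝓘(ℝ, E × E) 𝓘(ℝ, E).tangent (tangentParam φ) (z x) :=
      mfderivWithin_of_isOpen (φ.open_target.prod isOpen_univ) ⟨hzt x hx, mem_univ _⟩
  simp only [Function.comp, tangentMapWithin, this]

theorem IsLagrangian.continuousOn_fderiv_coordLagrangian [FiniteDimensional ℝ E]
    (hL : IsLagrangian U L) (hφ : φ ∈ IsManifold.maximalAtlas 𝓘(ℝ, E) ∞ M) :
    ContinuousOn (fun x : ℝ × E × E => fderiv ℝ (coordLagrangian φ L x.1) x.2)
      {x : ℝ × E × E | x.2.1 ∈ φ.target ∧ (x.1, tangentParam φ x.2) ∈ U} := by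
  rw [continuousOn_clm_apply]
  intro e
  refine (hL.continuousOn_dL_apply continuousOn_fst (continuousOn_mfderiv_tangentParam hφ
    continuousOn_snd (continuousOn_const (c := e)) fun x hx => hx.1) fun x hx => hx.2).congr fun x hx => ?_
  exact hL.fderiv_coordLagrangian_apply hφ hx.1 hx.2 e

end

/-! ### Coordinates of the cotangent bundle -/

section

variable {E : Type*} [NormedAddCommGroup E] [NormedSpace ℝ E]
  {M : Type*} [TopologicalSpace M] [ChartedSpace E M] [IsManifold 𝓘(ℝ, E) ∞ M]
  {φ : OpenPartialHomeomorph M E}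
variable {U : Set (ℝ × TangentBundle 𝓘(ℝ, E) M)} {L : ℝ × TangentBundle 𝓘(ℝ, E) M → ℝ}

/-- The coordinates on `TM^*` over the domain of a chart `φ` that are induced by `φ`. -/
def cotangentCoord (φ : OpenPartialHomeomorph M E) (p : CotangentBundle 𝓘(ℝ, E) M) :
    E × (E →L[ℝ] ℝ) :=
  (φ p.proj, (p.2 : E →L[ℝ] ℝ).comp (mfderiv 𝓘(ℝ, E) 𝓘(ℝ, E) φ.symm (φ p.proj) : E →L[ℝ] E))

theorem tangentParam_fiber (hφ : φ ∈ IsManifold.maximalAtlas 𝓘(ℝ, E) ∞ M)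
    {m : M} (hm : m ∈ φ.source) (w : E) :
    tangentParam φ (φ m, (mfderiv 𝓘(ℝ, E) 𝓘(ℝ, E) φ m w : E)) = ⟨m, w⟩ :=
  tangentParam_tangentCoord hφ (v := ⟨m, w⟩) hm

theorem IsLagrangian.differentiableAt_fiber (hL : IsLagrangian U L) {t : ℝ} {m : M} {w : E}
    (hU : (t, (⟨m, w⟩ : TangentBundle 𝓘(ℝ, E) M)) ∈ U) :
    DifferentiableAt ℝ (fun w' : E => L (t, ⟨m, w'⟩)) w := by
  have hφ := IsManifold.chart_mem_maximalAtlas (I := 𝓘(ℝ, E)) (n := ∞) m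
  have hm := mem_chart_source E m
  set φ := chartAt E m
  let B : E →L[ℝ] E := mfderiv 𝓘(ℝ, E) 𝓘(ℝ, E) φ m
  have h1 : (fun w' : E => L (t, ⟨m, w'⟩)) = fun w' => coordLagrangian φ L t (φ m, B w') := by
    funext w'
    exact congrArg (fun v => L (t, v)) (tangentParam_fiber hφ hm w').symm
  rw [h1]
  have h2 : DifferentiableAt ℝ (coordLagrangian φ L t) (φ m, B w) :=
    hL.differentiableAt_coordLagrangian hφ (φ.map_source hm) (by
      rw [show tangentParam φ (φ m, B w) = ⟨m, w⟩ from tangentParam_fiber hφ hm w]; exact hU)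
  exact DifferentiableAt.comp (g := coordLagrangian φ L t) (f := fun w' => (φ m, B w')) w h2
    (by fun_prop)

/-- Since `tangentParam φ` is linear on fibres, both covectors are the derivative of `w ↦
coordLagrangian φ L t (z.1, w)`, hence equal. -/
theorem IsLagrangian.cotangentCoord_FL (hL : IsLagrangian U L)
    (hφ : φ ∈ IsManifold.maximalAtlas 𝓘(ℝ, E) ∞ M) {t : ℝ} {z : E × E}
    (hz : z.1 ∈ φ.target) (hU : (t, tangentParam φ z) ∈ U) :
    cotangentCoord φ (FL L t (tangentParam φ z)) =
      (z.1, (fderiv ℝ (coordLagrangian φ L t) z).comp (ContinuousLinearMap.inr ℝ E E)) := by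
  refine Prod.ext (φ.right_inv hz) ?_
  let A : E → E →L[ℝ] E := fun q => mfderiv 𝓘(ℝ, E) 𝓘(ℝ, E) φ.symm q
  have h0 : (cotangentCoord φ (FL L t (tangentParam φ z))).2 =
      (fiberDeriv L t (φ.symm z.1) (A z.1 z.2)).comp (A (φ (φ.symm z.1))) := rfl
  rw [h0, φ.right_inv hz]
  have h1 : HasFDerivAt (fun w : E => coordLagrangian φ L t (z.1, w))
      ((fiberDeriv L t (φ.symm z.1) (A z.1 z.2)).comp (A z.1)) z.2 :=
    (hL.differentiableAt_fiber hU).hasFDerivAt.comp z.2 (A z.1).hasFDerivAt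
  have h2 : HasFDerivAt (fun w : E => coordLagrangian φ L t (z.1, w))
      ((fderiv ℝ (coordLagrangian φ L t) z).comp (ContinuousLinearMap.inr ℝ E E)) z.2 :=
    HasFDerivAt.comp (g := coordLagrangian φ L t) (f := fun w => (z.1, w)) z.2
      (hL.differentiableAt_coordLagrangian hφ hz hU).hasFDerivAt (hasFDerivAt_prodMk_right z.1 z.2)
  exact h1.unique h2

theorem extChartAt_cotangentBundle_source (p₀ : CotangentBundle 𝓘(ℝ, E) M) :
    (extChartAt (𝓘(ℝ, E).prod 𝓘(ℝ, E →L[ℝ] ℝ)) p₀).source =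
      TotalSpace.proj ⁻¹' (chartAt E p₀.proj).source := by
  rw [FiberBundle.extChartAt]
  ext p
  simp [hom_trivializationAt_source]
  exact fun h => h

theorem extChartAt_cotangentBundle_target (p₀ : CotangentBundle 𝓘(ℝ, E) M) :
    (extChartAt (𝓘(ℝ, E).prod 𝓘(ℝ, E →L[ℝ] ℝ)) p₀).target =
      (chartAt E p₀.proj).target ×ˢ univ := by
  rw [FiberBundle.extChartAt_target]
  ext p
  simp +contextual [OpenPartialHomeomorph.map_target]

theorem trivializationAt_cotangentBundle (x₀ : M) {p : CotangentBundle 𝓘(ℝ, E) M}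
    (hp : p.proj ∈ (chartAt E x₀).source) :
    (trivializationAt (E →L[ℝ] ℝ) (fun x : M => TangentSpace 𝓘(ℝ, E) x →L[ℝ] Trivial M ℝ x) x₀ p).2
      = (cotangentCoord (chartAt E x₀) p).2 := by
  rw [hom_trivializationAt_apply]
  have h := TangentBundle.symmL_trivializationAt (I := 𝓘(ℝ, E)) (𝕜 := ℝ) hp
  simp only [ContinuousLinearMap.inCoordinates, h]
  ext v
  simp [cotangentCoord]

/-- This identifies the charts of the bundle atlas with the classical coordinates `(q, p)`, so that
smoothness and derivatives in `TM^*` can be computed with `cotangentCoord`. -/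
theorem extChartAt_cotangentBundle (p₀ : CotangentBundle 𝓘(ℝ, E) M)
    {p : CotangentBundle 𝓘(ℝ, E) M} (hp : p.proj ∈ (chartAt E p₀.proj).source) :
    extChartAt (𝓘(ℝ, E).prod 𝓘(ℝ, E →L[ℝ] ℝ)) p₀ p = cotangentCoord (chartAt E p₀.proj) p := by
  rw [FiberBundle.extChartAt]
  refine Prod.ext ?_ ?_
  · simp [cotangentCoord]
    rfl
  · exact trivializationAt_cotangentBundle p₀.proj hp

end

/-! ### The canonical symplectic form in coordinates -/

section

variable {E : Type*} [NormedAddCommGroup E] [NormedSpace ℝ E]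
  {M : Type*} [TopologicalSpace M] [ChartedSpace E M] [IsManifold 𝓘(ℝ, E) ∞ M]
  {φ : OpenPartialHomeomorph M E}

local notation "J" => ModelWithCorners.prod 𝓘(ℝ, E) 𝓘(ℝ, E →L[ℝ] ℝ)

theorem cotangentCoord_extChartAt_symm (p₀ : CotangentBundle 𝓘(ℝ, E) M) {y : E × (E →L[ℝ] ℝ)}
    (hy : y.1 ∈ (chartAt E p₀.proj).target) :
    ((extChartAt J p₀).symm y).proj ∈ (chartAt E p₀.proj).source ∧
      cotangentCoord (chartAt E p₀.proj) ((extChartAt J p₀).symm y) = y := by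
  have hy' : y ∈ (extChartAt J p₀).target := by
    rw [extChartAt_cotangentBundle_target]; exact ⟨hy, mem_univ _⟩
  have h1 := (extChartAt J p₀).map_target hy'
  rw [extChartAt_cotangentBundle_source] at h1
  refine ⟨h1, ?_⟩
  rw [← extChartAt_cotangentBundle p₀ h1]
  exact (extChartAt J p₀).right_inv hy'

theorem extChartAt_symm_proj (p₀ : CotangentBundle 𝓘(ℝ, E) M) {y : E × (E →L[ℝ] ℝ)}
    (hy : y.1 ∈ (chartAt E p₀.proj).target) :
    ((extChartAt J p₀).symm y).proj = (chartAt E p₀.proj).symm y.1 := by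
  obtain ⟨h1, h2⟩ := cotangentCoord_extChartAt_symm p₀ hy
  rw [← congrArg Prod.fst h2]
  exact ((chartAt E p₀.proj).left_inv h1).symm

/-- This is `ϑ = p dq`. In coordinates the projection `TM^* → M` is `(q, p) ↦ q`, so by the chain
rule `dπ` sends a coordinate vector to the derivative of the inverse chart applied to its first
component; composing with the covector gives its coordinate `p`. -/
theorem canonicalForm_comp_mfderiv (p₀ : CotangentBundle 𝓘(ℝ, E) M) {y : E × (E →L[ℝ] ℝ)}
    (hy : y.1 ∈ (chartAt E p₀.proj).target) :
    ((canonicalForm ((extChartAt J p₀).symm y)).comp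
      (mfderivWithin 𝓘(ℝ, E × (E →L[ℝ] ℝ)) J (extChartAt J p₀).symm (range J) y) :
        E × (E →L[ℝ] ℝ) →L[ℝ] ℝ) = y.2.comp (ContinuousLinearMap.fst ℝ E (E →L[ℝ] ℝ)) := by
  obtain ⟨h1, h2⟩ := cotangentCoord_extChartAt_symm p₀ hy
  have hφ := IsManifold.chart_mem_maximalAtlas (I := 𝓘(ℝ, E)) (n := ∞) p₀.proj
  have hy' : y ∈ (extChartAt J p₀).target := by
    rw [extChartAt_cotangentBundle_target]; exact ⟨hy, mem_univ _⟩
  have hr : range J = univ := ModelWithCorners.range_eq_univ _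
  rw [hr, mfderivWithin_univ]
  have hd : MDifferentiableAt 𝓘(ℝ, E × (E →L[ℝ] ℝ)) J (extChartAt J p₀).symm y := by
    have := mdifferentiableWithinAt_extChartAt_symm (I := J) hy'
    rwa [hr, mdifferentiableWithinAt_univ] at this
  have hp : MDifferentiableAt J 𝓘(ℝ, E) (fun q : CotangentBundle 𝓘(ℝ, E) M => q.proj)
      ((extChartAt J p₀).symm y) :=
    (Bundle.contMDiffAt_proj (n := 1) _).mdifferentiableAt (by simp)
  have hc := mfderiv_comp y hp hd
  have he : ((fun q : CotangentBundle 𝓘(ℝ, E) M => q.proj) ∘ (extChartAt J p₀).symm) =ᶠ[𝓝 y]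
      (chartAt E p₀.proj).symm ∘ Prod.fst := by
    filter_upwards [((chartAt E p₀.proj).open_target.preimage continuous_fst).mem_nhds hy] with z hz
    exact extChartAt_symm_proj p₀ hz
  rw [he.mfderiv_eq] at hc
  have hs := (mdifferentiable_of_mem_maximalAtlas hφ).mdifferentiableAt_symm hy
  have hf : HasMFDerivAt 𝓘(ℝ, E × (E →L[ℝ] ℝ)) 𝓘(ℝ, E) (Prod.fst : E × (E →L[ℝ] ℝ) → E) y
      (ContinuousLinearMap.fst ℝ E (E →L[ℝ] ℝ)) := hasMFDerivAt_iff_hasFDerivAt.2 hasFDerivAt_fst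
  have hc' := (hs.hasMFDerivAt.comp y hf).mfderiv
  rw [hc'] at hc
  set q := (extChartAt J p₀).symm y
  have h4 : chartAt E p₀.proj q.proj = y.1 := congrArg Prod.fst h2
  have h3 : (q.2 : E →L[ℝ] ℝ).comp (mfderiv 𝓘(ℝ, E) 𝓘(ℝ, E) (chartAt E p₀.proj).symm
      (chartAt E p₀.proj q.proj) : E →L[ℝ] E) = y.2 := congrArg Prod.snd h2
  rw [h4] at h3
  refine ContinuousLinearMap.ext fun v => ?_
  exact (congrArg (q.2 : E →L[ℝ] ℝ) (DFunLike.congr_fun hc v)).symm.trans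
    (DFunLike.congr_fun h3 v.1)

/-- The coefficients of the form depend linearly on the second coordinate, so the pulled back form
is near the point a continuous linear map `B` and is its own derivative. The chart at `x` has the
identity as differential at `x`, so `u` and `v` need no conversion. -/
theorem extDerivOneForm_eq_of_eventually {X Y H N : Type*} [NormedAddCommGroup X] [NormedSpace ℝ X]
    [NormedAddCommGroup Y] [NormedSpace ℝ Y] [TopologicalSpace H] {I : ModelWithCorners ℝ (X × Y) H}
    [TopologicalSpace N] [ChartedSpace H N] [IsManifold I 1 N] (hr : range I = univ)
    {α : ∀ x : N, TangentSpace I x →L[ℝ] ℝ} {x : N} (A : Y →L[ℝ] X →L[ℝ] ℝ)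
    (h : ∀ᶠ y in 𝓝 (extChartAt I x x), (α ((extChartAt I x).symm y)).comp
      (mfderivWithin 𝓘(ℝ, X × Y) I (extChartAt I x).symm (range I) y) =
        (A y.2).comp (ContinuousLinearMap.fst ℝ X Y)) (u v : X × Y) :
    extDerivOneForm I α x u v = A u.2 v.1 - A v.2 u.1 := by
  let B : X × Y →L[ℝ] X × Y →L[ℝ] ℝ :=
    ((ContinuousLinearMap.compL ℝ (X × Y) X ℝ).flip (ContinuousLinearMap.fst ℝ X Y)).comp
      (A.comp (ContinuousLinearMap.snd ℝ X Y))
  let β : X × Y → X × Y →L[ℝ] ℝ := fun y => (α ((extChartAt I x).symm y)).comp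
    (mfderivWithin 𝓘(ℝ, X × Y) I (extChartAt I x).symm (range I) y)
  have hβ : HasFDerivAt β B (extChartAt I x x) :=
    HasFDerivAt.congr_of_eventuallyEq B.hasFDerivAt h
  have hm : mfderiv I 𝓘(ℝ, X × Y) (extChartAt I x) x = ContinuousLinearMap.id ℝ _ :=
    mfderiv_extChartAt_self
  have hD : fderivWithin ℝ β (range I) (extChartAt I x x) = B := by
    rw [hr, fderivWithin_univ, hβ.fderiv]
  have h0 : extDerivOneForm I α x u v =
      fderivWithin ℝ β (range I) (extChartAt I x x)
        (mfderiv I 𝓘(ℝ, X × Y) (extChartAt I x) x u) (mfderiv I 𝓘(ℝ, X × Y) (extChartAt I x) x v) -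
      fderivWithin ℝ β (range I) (extChartAt I x x)
        (mfderiv I 𝓘(ℝ, X × Y) (extChartAt I x) x v)
        (mfderiv I 𝓘(ℝ, X × Y) (extChartAt I x) x u) := rfl
  rw [h0, hm, hD]
  rfl

theorem symplecticForm_apply (p : CotangentBundle 𝓘(ℝ, E) M) (ζ η : E × (E →L[ℝ] ℝ)) :
    symplecticForm p ζ η = η.2 ζ.1 - ζ.2 η.1 := by
  have hp : (extChartAt J p p).1 ∈ (chartAt E p.proj).target := by
    have := mem_extChartAt_target (I := J) p
    rw [extChartAt_cotangentBundle_target] at this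
    exact this.1
  have h := extDerivOneForm_eq_of_eventually (I := J) (x := p)
    (ModelWithCorners.range_eq_univ _) (α := canonicalForm) (ContinuousLinearMap.id ℝ _) (by
    filter_upwards [((chartAt E p.proj).open_target.preimage continuous_fst).mem_nhds hp] with z hz
    exact canonicalForm_comp_mfderiv p hz) ζ η
  have h' : symplecticForm p ζ η = -(ζ.2 η.1 - η.2 ζ.1) := congrArg Neg.neg h
  rw [h']
  ring

end

/-! ### The Legendre transform -/

section

variable {E : Type*} [NormedAddCommGroup E] [NormedSpace ℝ E]
  {M : Type*} [TopologicalSpace M] [ChartedSpace E M] [IsManifold 𝓘(ℝ, E) ∞ M]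
  {φ : OpenPartialHomeomorph M E}
local notation "J" => ModelWithCorners.prod 𝓘(ℝ, E) 𝓘(ℝ, E →L[ℝ] ℝ)

/-- The Legendre transform in a vector space: its differential is expressed by that of `ℓ`. -/
theorem hasFDerivAt_legendre_of_injective [FiniteDimensional ℝ E] {ℓ : E × E → ℝ} {z₀ : E × E}
    {κ : E × E → E →L[ℝ] ℝ} {h : E × (E →L[ℝ] ℝ) → ℝ} (hℓ : DifferentiableAt ℝ ℓ z₀)
    (hκ : ContDiffAt ℝ 1 κ z₀) (hκ₀ : ∀ w, κ z₀ w = fderiv ℝ ℓ z₀ (0, w))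
    (hinj : ∀ w, fderiv ℝ κ z₀ (0, w) = 0 → w = 0)
    (hh : ∀ᶠ z in 𝓝 z₀, h (z.1, κ z) = κ z z.2 - ℓ z) :
    HasFDerivAt h ((ContinuousLinearMap.apply ℝ ℝ z₀.2).comp (ContinuousLinearMap.snd ℝ E (E →L[ℝ] ℝ))
      - ((fderiv ℝ ℓ z₀).comp (ContinuousLinearMap.inl ℝ E E)).comp
        (ContinuousLinearMap.fst ℝ E (E →L[ℝ] ℝ))) (z₀.1, κ z₀) := by
  -- The derivative of `(q, w) ↦ (q, κ(q, w))`. It is block triangular, so injectivity in the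
  -- `w`-direction makes it injective, hence bijective by dimension, and the inverse function
  -- theorem applies.
  let F' : E × E →L[ℝ] E × (E →L[ℝ] ℝ) := (ContinuousLinearMap.fst ℝ E E).prod (fderiv ℝ κ z₀)
  have hF'inj : Function.Injective F'.toLinearMap := by
    rw [← LinearMap.ker_eq_bot, LinearMap.ker_eq_bot']
    rintro ⟨q, w⟩ hqw
    have h1 : q = 0 := congrArg Prod.fst hqw
    have h2 : fderiv ℝ κ z₀ (q, w) = 0 := congrArg Prod.snd hqw
    subst h1
    rw [hinj w h2]; rfl
  have hrank : Module.finrank ℝ (E × E) = Module.finrank ℝ (E × (E →L[ℝ] ℝ)) := by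
    rw [Module.finrank_prod, Module.finrank_prod,
      ← (LinearMap.toContinuousLinearMap (𝕜 := ℝ) (E := E) (F' := ℝ)).finrank_eq,
      Module.finrank_linearMap, Module.finrank_self, mul_one]
  let e : (E × E) ≃L[ℝ] E × (E →L[ℝ] ℝ) :=
    (LinearEquiv.ofInjectiveOfFinrankEq F'.toLinearMap hF'inj hrank).toContinuousLinearEquiv
  have hF : HasStrictFDerivAt (fun z : E × E => (z.1, κ z)) (e : E × E →L[ℝ] E × (E →L[ℝ] ℝ)) z₀ := by
    have : (e : E × E →L[ℝ] E × (E →L[ℝ] ℝ)) = F' := by ext <;> rfl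
    rw [this]
    exact hasStrictFDerivAt_fst.prodMk (hκ.hasStrictFDerivAt (by simp))
  have hG := hF.to_localInverse
  have hG0 : hF.localInverse _ _ _ (z₀.1, κ z₀) = z₀ := hF.localInverse_apply_image
  have hFG := hF.eventually_right_inverse
  set G := hF.localInverse _ _ _ with hGdef
  have hcont : Filter.Tendsto G (𝓝 (z₀.1, κ z₀)) (𝓝 z₀) := by
    have := hG.hasFDerivAt.continuousAt
    rwa [ContinuousAt, hG0] at this
  -- Near the point `h(q, p) = p w - ℓ(q, w)`, where `(q, w) = G(q, p)` depends differentiably on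
  -- `(q, p)`.
  have heq : h =ᶠ[𝓝 (z₀.1, κ z₀)] fun y => y.2 (G y).2 - ℓ (G y) := by
    filter_upwards [hFG, hcont.eventually hh] with y hy1 hy2
    have h1 : (G y).1 = y.1 := congrArg Prod.fst hy1
    have h2 : κ (G y) = y.2 := congrArg Prod.snd hy1
    rw [h1, h2] at hy2
    exact hy2
  refine HasFDerivAt.congr_of_eventuallyEq ?_ heq
  have hG1 := hG.hasFDerivAt
  have d1 := (hasFDerivAt_snd (𝕜 := ℝ) (p := (z₀.1, κ z₀))).clm_apply
    (hG1.snd)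
  have hℓ' : HasFDerivAt ℓ (fderiv ℝ ℓ z₀) (G (z₀.1, κ z₀)) := by rw [hG0]; exact hℓ.hasFDerivAt
  have d2 := hℓ'.comp _ hG1
  refine (d1.sub d2).congr_fderiv ?_
  refine ContinuousLinearMap.ext fun y => ?_
  have k1 : ((e.symm y).1) = y.1 := by
    have := e.apply_symm_apply y
    exact congrArg Prod.fst this
  -- Splitting `dℓ` isolates `∂ℓ/∂w` applied to the derivative of `w`. By `hκ₀` it cancels against
  -- `p` applied to that derivative, so no derivative of `G` remains.
  have k2 : fderiv ℝ ℓ z₀ (e.symm y) = fderiv ℝ ℓ z₀ (y.1, 0) + fderiv ℝ ℓ z₀ (0, (e.symm y).2) := by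
    rw [← map_add, ← k1]; simp
  simp [hG0, hκ₀, k2]
  ring

variable {U : Set (ℝ × TangentBundle 𝓘(ℝ, E) M)} {L : ℝ × TangentBundle 𝓘(ℝ, E) M → ℝ}

theorem IsHyperRegular.injOn (hreg : IsHyperRegular U L) (t : ℝ) (m : M) :
    InjOn (fiberDeriv L t m) (fiber U t m) := by
  obtain ⟨-, -, G, -, hG⟩ := hreg t m
  intro w hw w' hw' h
  rw [← hG w hw, h, hG w' hw']

theorem IsHyperRegular.legendre_fiberDeriv (hreg : IsHyperRegular U L) {t : ℝ} {m : M} {w : E}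
    (hw : w ∈ fiber U t m) :
    legendre U L (t, ⟨m, fiberDeriv (E := E) L t m w⟩) = fiberDeriv L t m w w - L (t, ⟨m, w⟩) := by
  have h : Function.invFunOn (fiberDeriv L t m) (fiber U t m) (fiberDeriv L t m w) = w :=
    (hreg.injOn t m).leftInvOn_invFunOn hw
  simp only [legendre, h]

theorem IsLagrangian.isOpen_fiber (hL : IsLagrangian U L) (t : ℝ) (m : M) :
    IsOpen (fiber U t m) :=
  (hL.isOpen_slice t).preimage (FiberBundle.continuous_totalSpaceMk E (TangentSpace 𝓘(ℝ, E)) m)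

/-- Differentiating `G ∘ fiberDeriv L t m = id`, which holds on a neighbourhood of `w` because the
fibre of `U` is open, gives a left inverse of the derivative. -/
theorem fderiv_fiberDeriv_injective (hL : IsLagrangian U L) (hreg : IsHyperRegular U L)
    {t : ℝ} {m : M} {w : E} (hw : w ∈ fiber U t m) :
    DifferentiableAt ℝ (fiberDeriv L t m) w ∧
    ∀ u, fderiv ℝ (fiberDeriv L t m) w u = 0 → u = 0 := by
  obtain ⟨hopen, hF, G, hG, hGF⟩ := hreg t m
  have hwn := (hL.isOpen_fiber t m).mem_nhds hw
  have hFd := (hF.contDiffAt hwn).differentiableAt (by simp)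
  have hGd := (hG.contDiffAt (hopen.mem_nhds (mem_image_of_mem _ hw))).differentiableAt (by simp)
  refine ⟨hFd, fun u hu => ?_⟩
  have h1 := hGd.hasFDerivAt.comp w hFd.hasFDerivAt
  have h2 : HasFDerivAt (G ∘ fiberDeriv L t m) (ContinuousLinearMap.id ℝ E) w :=
    (hasFDerivAt_id w).congr_of_eventuallyEq (Filter.eventually_of_mem hwn hGF)
  have h3 := DFunLike.congr_fun (h1.unique h2) u
  simpa [hu] using h3.symm

end

/-! ### Hamiltonian vectors in coordinates -/

section

variable {E : Type*} [NormedAddCommGroup E] [NormedSpace ℝ E]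
  {M : Type*} [TopologicalSpace M] [ChartedSpace E M] [IsManifold 𝓘(ℝ, E) ∞ M]
  {φ : OpenPartialHomeomorph M E}
local notation "J" => ModelWithCorners.prod 𝓘(ℝ, E) 𝓘(ℝ, E →L[ℝ] ℝ)
variable {U : Set (ℝ × TangentBundle 𝓘(ℝ, E) M)} {L : ℝ × TangentBundle 𝓘(ℝ, E) M → ℝ}

theorem mfderiv_chartAt_self_apply (m : M) (w : E) :
    (mfderiv 𝓘(ℝ, E) 𝓘(ℝ, E) (chartAt E m) m w : E) = w :=
  DFunLike.congr_fun (mfderiv_extChartAt_self (I := 𝓘(ℝ, E)) (x := m)) w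

theorem tangentParam_chartAt (m : M) (w : E) :
    tangentParam (chartAt E m) (chartAt E m m, w) = ⟨m, w⟩ := by
  have h := tangentParam_fiber (IsManifold.chart_mem_maximalAtlas (I := 𝓘(ℝ, E)) (n := ∞) m)
    (mem_chart_source E m) w
  rwa [mfderiv_chartAt_self_apply] at h

theorem tangentCoord_chartAt (m : M) (w : E) :
    tangentCoord (chartAt E m) (⟨m, w⟩ : TangentBundle 𝓘(ℝ, E) M) = (chartAt E m m, w) :=
  Prod.ext rfl (mfderiv_chartAt_self_apply m w)

theorem cotangentCoord_injOn (m : M) :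
    InjOn (cotangentCoord (chartAt E m))
      {p : CotangentBundle 𝓘(ℝ, E) M | p.proj ∈ (chartAt E m).source} := by
  let p₀ : CotangentBundle 𝓘(ℝ, E) M := ⟨m, 0⟩
  intro p hp q hq hpq
  have h := (extChartAt J p₀).injOn
  rw [extChartAt_cotangentBundle_source] at h
  refine h hp hq ?_
  rw [extChartAt_cotangentBundle p₀ hp, extChartAt_cotangentBundle p₀ hq]
  exact hpq

/-- This is the `C¹` condition on `FL L t`, read in coordinates. Hyper-regularity gives regularity
along the fibres only; inverting `(q, w) ↦ (q, p)` needs `∂ℓ/∂w` to be `C¹` in `q` and `w` jointly.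
-/
theorem IsLagrangian.contDiffAt_fiber_coordLagrangian (hL : IsLagrangian U L) {t : ℝ} {m : M}
    {z : E × E} (hz : z.1 ∈ (chartAt E m).target) (hU : (t, tangentParam (chartAt E m) z) ∈ U) :
    ContDiffAt ℝ 1 (fun z => (fderiv ℝ (coordLagrangian (chartAt E m) L t) z).comp
      (ContinuousLinearMap.inr ℝ E E)) z := by
  have hφ := IsManifold.chart_mem_maximalAtlas (I := 𝓘(ℝ, E)) (n := ∞) m
  have hT : ContMDiffAt 𝓘(ℝ, E × E) 𝓘(ℝ, E).tangent 1 (tangentParam (chartAt E m)) z :=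
    ((contMDiffOn_tangentParam hφ).contMDiffAt
      (((chartAt E m).open_target.prod isOpen_univ).mem_nhds ⟨hz, mem_univ _⟩)).of_le (by simp)
  have hFL := ((hL.contMDiffOn_FL t).contMDiffAt ((hL.isOpen_slice t).mem_nhds hU)).comp z hT
  have hs : (chartAt E m).symm z.1 ∈ (chartAt E m).source := (chartAt E m).map_target hz
  let e := trivializationAt (E →L[ℝ] ℝ)
    (fun x : M => TangentSpace 𝓘(ℝ, E) x →L[ℝ] Trivial M ℝ x) m
  have hmem : (FL L t ∘ tangentParam (chartAt E m)) z ∈ e.source := by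
    rw [hom_trivializationAt_source]
    exact ⟨hs, mem_univ _⟩
  have h := ((e.contMDiffAt_iff hmem).1 hFL).2
  rw [← contMDiffAt_iff_contDiffAt]
  refine h.congr_of_eventuallyEq ?_
  have hopen := (isOpen_preimage_tangentParam hφ hL.isOpen).preimage
    (by fun_prop : Continuous fun z : E × E => (t, z))
  filter_upwards [hopen.mem_nhds ⟨hz, hU⟩] with z' hz'
  have h1 := trivializationAt_cotangentBundle m
    (p := FL L t (tangentParam (chartAt E m) z')) ((chartAt E m).map_target hz'.1)
  exact (congrArg Prod.snd (hL.cotangentCoord_FL hφ hz'.1 hz'.2)).symm.trans h1.symm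

theorem hasMFDerivAt_legendre [FiniteDimensional ℝ E] (hL : IsLagrangian U L)
    (hreg : IsHyperRegular U L) {t : ℝ} {m : M} {w : E} (hw : w ∈ fiber U t m) :
    HasMFDerivAt J 𝓘(ℝ, ℝ) (fun q => legendre U L (t, q)) (FL L t ⟨m, w⟩)
      ((ContinuousLinearMap.apply ℝ ℝ w).comp (ContinuousLinearMap.snd ℝ E (E →L[ℝ] ℝ))
      - ((fderiv ℝ (coordLagrangian (chartAt E m) L t) (chartAt E m m, w)).comp
        (ContinuousLinearMap.inl ℝ E E)).comp (ContinuousLinearMap.fst ℝ E (E →L[ℝ] ℝ)) :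
        E × (E →L[ℝ] ℝ) →L[ℝ] ℝ) := by
  have hφ := IsManifold.chart_mem_maximalAtlas (I := 𝓘(ℝ, E)) (n := ∞) m
  have hm := mem_chart_source E m
  set φ := chartAt E m with hφdef
  set z₀ : E × E := (φ m, w) with hz₀
  have hz₀t : z₀.1 ∈ φ.target := φ.map_source hm
  have hTz : tangentParam φ z₀ = ⟨m, w⟩ := tangentParam_chartAt m w
  have hUz : (t, tangentParam φ z₀) ∈ U := by rw [hTz]; exact hw
  set p : CotangentBundle 𝓘(ℝ, E) M := FL L t ⟨m, w⟩ with hp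
  let κ : E × E → E →L[ℝ] ℝ := fun z => (fderiv ℝ (coordLagrangian φ L t) z).comp
      (ContinuousLinearMap.inr ℝ E E)
  have hκ : ContDiffAt ℝ 1 κ z₀ := hL.contDiffAt_fiber_coordLagrangian hz₀t hUz
  have hopen := (isOpen_preimage_tangentParam hφ hL.isOpen).preimage
    (by fun_prop : Continuous fun z : E × E => (t, z))
  have hpc : cotangentCoord φ p = (z₀.1, κ z₀) := by
    rw [hp, ← hTz]; exact hL.cotangentCoord_FL hφ hz₀t hUz
  -- On the fibre over `m` the coordinates of the chart at `m` are the identity, so `κ (φ m, ·)` is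
  -- `fiberDeriv L t m` near `w` and hyper-regularity applies.
  have hinj : ∀ u, fderiv ℝ κ z₀ (0, u) = 0 → u = 0 := by
    intro u hu
    obtain ⟨hd, hi⟩ := fderiv_fiberDeriv_injective hL hreg hw
    have h1 : HasFDerivAt (fun w' => κ (φ m, w'))
        ((fderiv ℝ κ z₀).comp (ContinuousLinearMap.inr ℝ E E)) w :=
      HasFDerivAt.comp (g := κ) (f := fun w' => (φ m, w')) w
        (hκ.differentiableAt (by simp)).hasFDerivAt (hasFDerivAt_prodMk_right (φ m) w)
    have h2 : fiberDeriv L t m =ᶠ[𝓝 w] fun w' => κ (φ m, w') := by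
      filter_upwards [(hL.isOpen_fiber t m).mem_nhds hw] with w' hw'
      have hTz' : tangentParam φ (φ m, w') = ⟨m, w'⟩ := tangentParam_chartAt m w'
      have h3 : HasFDerivAt (fun w' : E => coordLagrangian φ L t (φ m, w')) (κ (φ m, w')) w' :=
        HasFDerivAt.comp (g := coordLagrangian φ L t) (f := fun w => (φ m, w)) w'
          (hL.differentiableAt_coordLagrangian (t := t) (z := (φ m, w')) hφ hz₀t
            (by rw [hTz']; exact hw')).hasFDerivAt
          (hasFDerivAt_prodMk_right (φ m) w')
      rw [← h3.fderiv]
      have h4 : (fun w' : E => L (t, ⟨m, w'⟩)) = fun w' : E => coordLagrangian φ L t (φ m, w') := by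
        funext w''
        exact congrArg (fun v => L (t, v)) (tangentParam_chartAt m w'').symm
      exact congrArg (fun f => fderiv ℝ f w') h4
    have h5 := (h1.congr_of_eventuallyEq h2).fderiv
    exact hi u (by rw [h5]; exact hu)
  -- The point with coordinates `(q, ∂ℓ/∂w)` is `FL L t (tangentParam φ z)`, and the pairing of a
  -- covector with a vector is the same in coordinates as on `M`.
  have hh : ∀ᶠ z in 𝓝 z₀, (fun y => legendre U L (t, (extChartAt J p).symm y)) (z.1, κ z) =
      κ z z.2 - coordLagrangian φ L t z := by
    filter_upwards [hopen.mem_nhds ⟨hz₀t, hUz⟩] with z hz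
    obtain ⟨k1, k2⟩ := cotangentCoord_extChartAt_symm p (y := (z.1, κ z)) hz.1
    have k3 := hL.cotangentCoord_FL hφ hz.1 hz.2
    have k4 : (extChartAt J p).symm (z.1, κ z) = FL L t (tangentParam φ z) :=
      cotangentCoord_injOn m k1 (φ.map_target hz.1) (k2.trans k3.symm)
    have k5 := hreg.legendre_fiberDeriv (t := t) (m := φ.symm z.1)
      (w := (mfderiv 𝓘(ℝ, E) 𝓘(ℝ, E) φ.symm z.1 z.2 : E)) hz.2
    simp only [k4]
    refine k5.trans ?_
    have k6 := DFunLike.congr_fun (congrArg Prod.snd k3) z.2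
    have k7 : (fiberDeriv (E := E) L t (φ.symm z.1) (mfderiv 𝓘(ℝ, E) 𝓘(ℝ, E) φ.symm z.1 z.2 : E))
      (mfderiv 𝓘(ℝ, E) 𝓘(ℝ, E) φ.symm (φ (φ.symm z.1)) z.2 : E) = κ z z.2 := k6
    rw [φ.right_inv hz.1] at k7
    rw [k7]
    rfl
  have hmain := hasFDerivAt_legendre_of_injective
    (h := fun y => legendre U L (t, (extChartAt J p).symm y))
    (hL.differentiableAt_coordLagrangian hφ hz₀t hUz) hκ (fun _ => rfl) hinj hh
  have hpe : extChartAt J p p = (z₀.1, κ z₀) :=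
    (extChartAt_cotangentBundle (p := p) p hm).trans hpc
  rw [← hpe] at hmain
  -- The chart at `p` has the identity as differential at `p`, so the derivative found in
  -- coordinates is already the one on `TM^*`.
  have hext : HasMFDerivAt J 𝓘(ℝ, E × (E →L[ℝ] ℝ)) (extChartAt J p) p
      (ContinuousLinearMap.id ℝ (E × (E →L[ℝ] ℝ))) := by
    have h1 := (mdifferentiableAt_extChartAt (I := J) (mem_chart_source _ p)).hasMFDerivAt
    rwa [mfderiv_extChartAt_self] at h1
  have hcomp := (hasMFDerivAt_iff_hasFDerivAt.2 hmain).comp p hext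
  refine (hcomp.congr_of_eventuallyEq ?_).congr_mfderiv ?_
  · filter_upwards [(isOpen_extChartAt_source (I := J) p).mem_nhds (mem_extChartAt_source p)]
      with q hq
    exact congrArg (fun q => legendre U L (t, q)) ((extChartAt J p).left_inv hq).symm
  · rfl

/-- These are the Hamilton equations `q' = w`, `p' = ∂ℓ/∂q`. They follow by comparing `η.2 ζ.1 - ζ.2
η.1` with `dH(η)` on the vectors `η = (0, g)` and `η = (e, 0)`. -/
theorem isHamiltonianVector_FL_iff [FiniteDimensional ℝ E] (hL : IsLagrangian U L)
    (hreg : IsHyperRegular U L) {t : ℝ} {m : M} {w : E} (hw : w ∈ fiber U t m)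
    (ζ : E × (E →L[ℝ] ℝ)) :
    IsHamiltonianVector (legendre U L) t (FL L t ⟨m, w⟩) ζ ↔ ζ.1 = w ∧
      ζ.2 = (fderiv ℝ (coordLagrangian (chartAt E m) L t) (chartAt E m m, w)).comp
        (ContinuousLinearMap.inl ℝ E E) := by
  have h := hasMFDerivAt_legendre hL hreg hw
  set ℓ := fderiv ℝ (coordLagrangian (chartAt E m) L t) (chartAt E m m, w)
  have key : IsHamiltonianVector (legendre U L) t (FL L t ⟨m, w⟩) ζ ↔
      ∀ η : E × (E →L[ℝ] ℝ), η.2 ζ.1 - ζ.2 η.1 = η.2 w - ℓ (η.1, 0) := by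
    have h1 (η : E × (E →L[ℝ] ℝ)) : (mfderiv J 𝓘(ℝ, ℝ) (fun q => legendre U L (t, q))
        (FL L t ⟨m, w⟩) η : ℝ) = η.2 w - ℓ (η.1, 0) := DFunLike.congr_fun h.mfderiv η
    have h2 (η : E × (E →L[ℝ] ℝ)) := symplecticForm_apply (FL L t ⟨m, w⟩) ζ η
    exact ⟨fun h' η => ((h2 η).symm.trans (h'.2 η)).trans (h1 η), fun h' =>
      ⟨h.mdifferentiableAt, fun η => ((h2 η).trans (h' η)).trans (h1 η).symm⟩⟩
  rw [key]
  constructor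
  · intro h'
    constructor
    · refine (SeparatingDual.eq_iff_forall_dual_eq (R := ℝ)).2 fun g => ?_
      have h1 : g ζ.1 - ζ.2 0 = g w - ℓ 0 := h' (0, g)
      simpa using h1
    · ext e
      have h1 : 0 - ζ.2 e = 0 - ℓ (e, 0) := h' (e, 0)
      simpa using h1
  · rintro ⟨h1, h2⟩ η
    rw [h1, h2]
    simp

end

/-! ### Two lemmas of calculus -/

section

variable {E : Type*} [NormedAddCommGroup E] [NormedSpace ℝ E]
  {M : Type*} [TopologicalSpace M] [ChartedSpace E M] [IsManifold 𝓘(ℝ, E) ∞ M]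
  {φ : OpenPartialHomeomorph M E}

/-- Interchange of `∂_t` and `∂_s` when only one mixed derivative, `β = ∂_s ∂_t q`, is known to
exist. The second difference of `q` is compared with `s (t - t₀) β(0, t₀)` by two mean value
inequalities, one in `s` and one in `t`. It applies to variations, which need not have second
derivatives in `t`. -/
theorem hasDerivWithinAt_of_mixed_deriv {q w β : ℝ → ℝ → E} {α : ℝ → E} {S : Set ℝ} {t₀ ε : ℝ}
    (hε : 0 < ε) (hS : Convex ℝ S) (ht₀ : t₀ ∈ S)
    (hq : ∀ s ∈ Ioo (-ε) ε, ∀ t ∈ S, HasDerivWithinAt (q s) (w s t) S t)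
    (hα : ∀ t ∈ S, HasDerivAt (fun s => q s t) (α t) 0)
    (hβ : ∀ s ∈ Ioo (-ε) ε, ∀ t ∈ S, HasDerivAt (fun s => w s t) (β s t) s)
    (hc : ContinuousWithinAt (fun x : ℝ × ℝ => β x.1 x.2) (Ioo (-ε) ε ×ˢ S) (0, t₀)) :
    HasDerivWithinAt α (β 0 t₀) S t₀ := by
  rw [hasDerivWithinAt_iff_isLittleO, Asymptotics.isLittleO_iff]
  intro c hc0
  obtain ⟨δ, hδ, hδc⟩ := Metric.continuousWithinAt_iff.1 hc c hc0
  have hm : ∀ t ∈ S ∩ Metric.ball t₀ δ, ‖α t - α t₀ - (t - t₀) • β 0 t₀‖ ≤ c * ‖t - t₀‖ := by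
    intro t ht
    have hconv : Convex ℝ (S ∩ Metric.ball t₀ δ) := hS.inter (convex_ball t₀ δ)
    -- The quantity to be estimated is the derivative at `s = 0` of this function, so a bound on the
    -- increments of the function by a multiple of `|s|` suffices.
    have h1 : HasDerivAt (fun s => q s t - q s t₀ - s • ((t - t₀) • β 0 t₀))
        (α t - α t₀ - (t - t₀) • β 0 t₀) 0 := by
      simpa using ((hα t ht.1).fun_sub (hα t₀ ht₀)).fun_sub
        ((hasDerivAt_id (0 : ℝ)).smul_const ((t - t₀) • β 0 t₀))
    refine h1.le_of_lip' (by positivity) ?_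
    have hd : 0 < min ε δ := lt_min hε hδ
    filter_upwards [Ioo_mem_nhds (neg_lt_zero.2 hd) hd] with s hs
    have hs1 : ∀ σ ∈ Ioo (-min ε δ) (min ε δ), σ ∈ Ioo (-ε) ε ∧ |σ| < δ := fun σ hσ =>
      ⟨⟨by linarith [hσ.1, min_le_left ε δ], by linarith [hσ.2, min_le_left ε δ]⟩,
        abs_lt.2 ⟨by linarith [hσ.1, min_le_right ε δ], by linarith [hσ.2, min_le_right ε δ]⟩⟩
    have h0 : (0 : ℝ) ∈ Ioo (-min ε δ) (min ε δ) := ⟨neg_lt_zero.2 hd, hd⟩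
    have h2 : ∀ τ ∈ S ∩ Metric.ball t₀ δ, ‖w s τ - w 0 τ - s • β 0 t₀‖ ≤ c * |s| := by
      intro τ hτ
      have h3 : ∀ σ ∈ Ioo (-min ε δ) (min ε δ),
          HasDerivWithinAt (fun σ => w σ τ - σ • β 0 t₀) (β σ τ - β 0 t₀)
            (Ioo (-min ε δ) (min ε δ)) σ := by
        intro σ hσ
        simpa using ((hβ σ (hs1 σ hσ).1 τ hτ.1).fun_sub
          ((hasDerivAt_id σ).smul_const (β 0 t₀))).hasDerivWithinAt
      have h4 := (convex_Ioo (-min ε δ) (min ε δ)).norm_image_sub_le_of_norm_hasDerivWithin_le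
        (C := c) h3 (fun σ hσ => by
          rw [← dist_eq_norm]
          refine (hδc (x := (σ, τ)) ⟨(hs1 σ hσ).1, hτ.1⟩ ?_).le
          rw [Prod.dist_eq]
          exact max_lt (by simpa using (hs1 σ hσ).2) hτ.2) h0 hs
      have h5 : w s τ - s • β 0 t₀ - (w 0 τ - (0 : ℝ) • β 0 t₀) = w s τ - w 0 τ - s • β 0 t₀ := by
        rw [zero_smul]; abel
      rwa [h5, sub_zero, Real.norm_eq_abs] at h4
    have h6 : ∀ τ ∈ S ∩ Metric.ball t₀ δ,
        HasDerivWithinAt (fun τ => q s τ - q 0 τ - (τ - t₀) • (s • β 0 t₀))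
          (w s τ - w 0 τ - s • β 0 t₀) (S ∩ Metric.ball t₀ δ) τ := by
      intro τ hτ
      have h7 := (((hq s (hs1 s hs).1 τ hτ.1).fun_sub (hq 0 (hs1 0 h0).1 τ hτ.1)).fun_sub
        (((hasDerivAt_id τ).sub_const t₀).smul_const (s • β 0 t₀)).hasDerivWithinAt).mono
          (inter_subset_left (t := Metric.ball t₀ δ))
      simpa using h7
    have h8 := hconv.norm_image_sub_le_of_norm_hasDerivWithin_le h6 h2
      ⟨ht₀, Metric.mem_ball_self hδ⟩ ht
    have h9 : q s t - q s t₀ - s • ((t - t₀) • β 0 t₀) -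
        (q 0 t - q 0 t₀ - (0 : ℝ) • ((t - t₀) • β 0 t₀)) =
        q s t - q 0 t - (t - t₀) • (s • β 0 t₀) - (q s t₀ - q 0 t₀ - (t₀ - t₀) • (s • β 0 t₀)) := by
      rw [sub_self, zero_smul, zero_smul, smul_comm s]; abel
    rw [h9, sub_zero, Real.norm_eq_abs s]
    calc _ ≤ c * |s| * ‖t - t₀‖ := h8
      _ = _ := by ring
  exact Filter.eventually_of_mem (inter_mem_nhdsWithin S (Metric.ball_mem_nhds t₀ hδ)) hm

/-- The lemma of du Bois-Reymond. -/
theorem hasDerivWithinAt_of_integral_eq_zero {A B : ℝ → ℝ} {a b : ℝ} (hab : a < b)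
    (hA : ContinuousOn A (Icc a b)) (hB : ContinuousOn B (Icc a b))
    (h : ∀ η θ : ℝ → ℝ, Continuous θ → (∀ t, HasDerivAt η (θ t) t) → (∀ t ∉ Ioo a b, η t = 0) →
      ∫ t in a..b, (A t * η t + B t * θ t) = 0) :
    ∀ t ∈ Icc a b, HasDerivWithinAt B (A t) (Icc a b) t := by
  -- Continuous extensions to the line make every primitive below differentiable everywhere, also at
  -- `a` and `b`.
  let A' : ℝ → ℝ := IccExtend hab.le ((Icc a b).domRestrict A)
  let B' : ℝ → ℝ := IccExtend hab.le ((Icc a b).domRestrict B)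
  have hA' : Continuous A' := (continuousOn_iff_continuous_domRestrict.1 hA).Icc_extend'
  have hB' : Continuous B' := (continuousOn_iff_continuous_domRestrict.1 hB).Icc_extend'
  have hAA' : ∀ t ∈ Icc a b, A' t = A t := fun t ht => IccExtend_of_mem _ _ ht
  have hBB' : ∀ t ∈ Icc a b, B' t = B t := fun t ht => IccExtend_of_mem _ _ ht
  let 𝒜 : ℝ → ℝ := fun t => ∫ τ in a..t, A' τ
  have h𝒜 : ∀ t, HasDerivAt 𝒜 (A' t) t := fun t =>
    intervalIntegral.integral_hasDerivAt_right (hA'.intervalIntegrable _ _)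
      hA'.aestronglyMeasurable.stronglyMeasurableAtFilter hA'.continuousAt
  have h𝒜c : Continuous 𝒜 := continuous_iff_continuousAt.2 fun t => (h𝒜 t).continuousAt
  let D : ℝ → ℝ := fun t => B' t - 𝒜 t
  have hD : Continuous D := hB'.sub h𝒜c
  -- The usual test function has derivative `D - m`, which need not vanish at the end points. The
  -- weight `χ` makes `θ = χ (D - m)` continuous on the line and zero outside `(a, b)`.
  let χ : ℝ → ℝ := fun t => max ((t - a) * (b - t)) 0
  have hχ : Continuous χ := by fun_prop
  have hχpos : ∀ t ∈ Ioo a b, 0 < χ t := fun t ht =>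
    lt_max_of_lt_left (mul_pos (sub_pos.2 ht.1) (sub_pos.2 ht.2))
  have hχ0 : ∀ t ∉ Ioo a b, χ t = 0 := by
    intro t ht
    refine max_eq_right ?_
    rcases le_or_gt t a with h1 | h1
    · exact mul_nonpos_of_nonpos_of_nonneg (by linarith) (by linarith)
    · have h2 : b ≤ t := not_lt.1 fun h2 => ht ⟨h1, h2⟩
      exact mul_nonpos_of_nonneg_of_nonpos (by linarith) (by linarith)
  have hχint : 0 < ∫ t in a..b, χ t :=
    intervalIntegral.intervalIntegral_pos_of_pos_on (hχ.intervalIntegrable _ _) hχpos hab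
  -- The `χ`-weighted mean of `D`, so that `∫ θ = 0` and the primitive `η` vanishes beyond `b` as
  -- well.
  let m : ℝ := (∫ t in a..b, χ t * D t) / ∫ t in a..b, χ t
  let θ : ℝ → ℝ := fun t => χ t * (D t - m)
  have hθ : Continuous θ := by fun_prop
  have hθint : ∫ t in a..b, θ t = 0 := by
    have h1 : ∀ t, θ t = χ t * D t - χ t * m := fun t => by simp only [θ]; ring
    simp only [h1]
    rw [intervalIntegral.integral_sub
      (Continuous.intervalIntegrable (by fun_prop) _ _)
      (Continuous.intervalIntegrable (by fun_prop) _ _), intervalIntegral.integral_mul_const]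
    simp only [m]
    field_simp
    ring
  let η : ℝ → ℝ := fun t => ∫ τ in a..t, θ τ
  have hη : ∀ t, HasDerivAt η (θ t) t := fun t =>
    intervalIntegral.integral_hasDerivAt_right (hθ.intervalIntegrable _ _)
      hθ.aestronglyMeasurable.stronglyMeasurableAtFilter hθ.continuousAt
  have hηc : Continuous η := continuous_iff_continuousAt.2 fun t => (hη t).continuousAt
  have hθ0 : ∀ t ∉ Ioo a b, θ t = 0 := fun t ht => by simp [θ, hχ0 t ht]
  have hη0 : ∀ t ∉ Ioo a b, η t = 0 := by
    intro t ht
    rcases le_or_gt t a with h1 | h1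
    · refine intervalIntegral.integral_zero_ae (Filter.Eventually.of_forall fun τ hτ => hθ0 τ ?_)
      rw [uIoc_of_ge h1] at hτ
      exact fun h2 => absurd h2.1 (not_lt.2 hτ.2)
    · have h2 : b ≤ t := not_lt.1 fun h2 => ht ⟨h1, h2⟩
      have h3 : ∫ τ in b..t, θ τ = 0 := by
        refine intervalIntegral.integral_zero_ae (Filter.Eventually.of_forall fun τ hτ => hθ0 τ ?_)
        rw [uIoc_of_le h2] at hτ
        exact fun h4 => absurd h4.2 (not_lt.2 hτ.1.le)
      simp only [η]
      rw [← intervalIntegral.integral_add_adjacent_intervals (hθ.intervalIntegrable a b)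
        (hθ.intervalIntegrable b t), hθint, h3, add_zero]
  have h1 := h η θ hθ hη hη0
  have h2 : ∫ t in a..b, (A' t * η t + 𝒜 t * θ t) = 0 := by
    rw [intervalIntegral.integral_deriv_mul_eq_sub (fun t _ => h𝒜 t) (fun t _ => hη t)
      (hA'.intervalIntegrable _ _) (hθ.intervalIntegrable _ _),
      hη0 a (by simp), hη0 b (by simp)]
    simp
  have h3 : ∫ t in a..b, (A t * η t + B t * θ t) = ∫ t in a..b, (A' t * η t + B' t * θ t) := by
    refine intervalIntegral.integral_congr fun t ht => ?_
    rw [uIcc_of_le hab.le] at ht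
    simp only [hAA' t ht, hBB' t ht]
  -- Integration by parts (`h2`) turns the hypothesis into `∫ D θ = 0`; with `∫ θ = 0` this is `∫ (D
  -- - m) θ = 0`.
  have h4 : ∫ t in a..b, χ t * (D t - m) ^ 2 = 0 := by
    have h5 : ∀ t, χ t * (D t - m) ^ 2 =
        (A' t * η t + B' t * θ t) - (A' t * η t + 𝒜 t * θ t) - m * θ t := fun t => by
      simp only [θ, D]; ring
    simp only [h5]
    rw [intervalIntegral.integral_sub, intervalIntegral.integral_sub, ← h3, h1, h2,
      intervalIntegral.integral_const_mul, hθint]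
    · simp
    all_goals exact Continuous.intervalIntegrable (by fun_prop) _ _
  have h6 : ∀ t ∈ Ioo a b, D t = m := by
    by_contra! hne
    obtain ⟨t, ht, hne⟩ := hne
    refine h4.not_gt (intervalIntegral.integral_pos hab (by fun_prop) (fun τ _ => ?_)
      ⟨t, Ioo_subset_Icc_self ht, ?_⟩)
    · exact mul_nonneg (le_max_right _ _) (sq_nonneg _)
    · have := sub_ne_zero.2 hne
      have := hχpos t ht
      positivity
  have h7 : ∀ t ∈ Icc a b, D t = m := by
    have hcl : IsClosed {t | D t = m} := isClosed_eq hD continuous_const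
    have := hcl.closure_subset_iff.2 (show Ioo a b ⊆ {t | D t = m} from h6)
    rwa [closure_Ioo hab.ne] at this
  intro t ht
  have h8 : HasDerivWithinAt (fun t => m + 𝒜 t) (A' t) (Icc a b) t :=
    ((h𝒜 t).const_add m).hasDerivWithinAt
  rw [hAA' t ht] at h8
  have h9 : ∀ t ∈ Icc a b, B t = m + 𝒜 t := fun t ht => by
    rw [← hBB' t ht, ← h7 t ht]; simp [D]
  exact h8.congr h9 (h9 t ht)

end

/-! ### The derivative of the action -/

section

variable {E : Type*} [NormedAddCommGroup E] [NormedSpace ℝ E]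
  {M : Type*} [TopologicalSpace M] [ChartedSpace E M] [IsManifold 𝓘(ℝ, E) ∞ M]
  {φ : OpenPartialHomeomorph M E}
variable {U : Set (ℝ × TangentBundle 𝓘(ℝ, E) M)} {L : ℝ × TangentBundle 𝓘(ℝ, E) M → ℝ}

/-- The derivative with respect to `s` of the velocity of a family `s ↦ c s` of curves. -/
def velocityDeriv (a b : ℝ) (c : ℝ → ℝ → M) (s t : ℝ) : E × E :=
  (mfderiv 𝓘(ℝ, ℝ) 𝓘(ℝ, E).tangent (fun s' => velocity (E := E) a b (c s') t) s (1 : ℝ) : E × E)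

variable {P Q : Set M} {a b ε : ℝ} {γ : ℝ → M} {c : ℝ → ℝ → M}

theorem IsVariation.continuousOn_dL (hL : IsLagrangian U L) (hc : IsVariation U P Q a b γ ε c) :
    ContinuousOn (fun x : ℝ × ℝ => (dL L x.2 (velocity a b (c x.1) x.2)
      (velocityDeriv a b c x.1 x.2) : ℝ)) (Ioo (-ε) ε ×ˢ Icc a b) :=
  hL.continuousOn_dL_apply continuousOn_snd hc.continuousOn_deriv
    fun x hx => (hc.admissible x.1 hx.1).velocity_mem x.2 hx.2

theorem IsVariation.continuousOn_velocity (hc : IsVariation U P Q a b γ ε c) :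
    ContinuousOn (fun x : ℝ × ℝ => velocity (E := E) a b (c x.1) x.2) (Ioo (-ε) ε ×ˢ Icc a b) :=
  (FiberBundle.continuous_proj (E × E) _).comp_continuousOn hc.continuousOn_deriv

theorem IsVariation.hasDerivAt_lagrangian (hL : IsLagrangian U L)
    (hc : IsVariation U P Q a b γ ε c) {s t : ℝ} (hs : s ∈ Ioo (-ε) ε) (ht : t ∈ Icc a b) :
    HasDerivAt (fun s => L (t, velocity a b (c s) t))
      (dL L t (velocity a b (c s) t) (velocityDeriv a b c s t)) s := by
  have h1 := (hL.mdifferentiableAt ((hc.admissible s hs).velocity_mem t ht)).hasMFDerivAt.comp s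
    (hc.mdifferentiableAt s hs t ht).hasMFDerivAt
  have h2 : ∀ (A : E × E →L[ℝ] ℝ) (B : ℝ →L[ℝ] E × E),
    HasFDerivAt (fun s => L (t, velocity a b (c s) t)) (A.comp B) s →
    HasDerivAt (fun s => L (t, velocity a b (c s) t)) (A (B 1)) s := fun A B h => h.hasDerivAt
  exact h2 _ _ (hasMFDerivAt_iff_hasFDerivAt.1 h1)

theorem IsVariation.hasDerivAt_action (hL : IsLagrangian U L) (hab : a ≤ b) (hε : 0 < ε)
    (hc : IsVariation U P Q a b γ ε c) :
    HasDerivAt (fun s => action L a b (c s))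
      (∫ t in a..b, (dL L t (velocity a b (c 0) t) (velocityDeriv a b c 0 t) : ℝ)) 0 := by
  -- Halving `ε` gives a compact rectangle, where the continuous integrand has a constant bound for
  -- dominated differentiation.
  have hsub : Icc (-(ε / 2)) (ε / 2) ×ˢ Icc a b ⊆ Ioo (-ε) ε ×ˢ Icc a b :=
    prod_mono (Icc_subset_Ioo (by linarith) (by linarith)) subset_rfl
  obtain ⟨C, hC⟩ := (isCompact_Icc.prod isCompact_Icc).exists_bound_of_continuousOn
    ((hc.continuousOn_dL hL).mono hsub)
  have h0 : (0 : ℝ) ∈ Ioo (-ε) ε := ⟨by linarith, hε⟩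
  have huIoc : uIoc a b ⊆ Icc a b := by rw [uIoc_of_le hab]; exact Ioc_subset_Icc_self
  have hF : ∀ s ∈ Ioo (-ε) ε, ContinuousOn (fun t => L (t, velocity a b (c s) t)) (Icc a b) := by
    intro s hs
    refine hL.continuousOn.comp (continuousOn_id.prodMk ?_)
      fun t ht => (hc.admissible s hs).velocity_mem t ht
    exact hc.continuousOn_velocity.comp (continuousOn_const.prodMk continuousOn_id)
      fun t ht => ⟨hs, ht⟩
  have hF' : ContinuousOn (fun t => (dL L t (velocity a b (c 0) t) (velocityDeriv a b c 0 t) : ℝ))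
      (Icc a b) :=
    (hc.continuousOn_dL hL).comp (continuousOn_const.prodMk continuousOn_id) fun t ht => ⟨h0, ht⟩
  have hmeas : ∀ {f : ℝ → ℝ}, ContinuousOn f (Icc a b) →
      MeasureTheory.AEStronglyMeasurable f (MeasureTheory.volume.restrict (uIoc a b)) :=
    fun hf => (hf.mono huIoc).aestronglyMeasurable measurableSet_uIoc
  refine (intervalIntegral.hasDerivAt_integral_of_dominated_loc_of_deriv_le
    (F := fun s t => L (t, velocity a b (c s) t))
    (F' := fun s t => (dL L t (velocity a b (c s) t) (velocityDeriv a b c s t) : ℝ))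
    (s := Ioo (-(ε / 2)) (ε / 2)) (bound := fun _ => C)
    (Ioo_mem_nhds (by linarith) (by linarith)) ?_ ?_ (hmeas hF') ?_ ?_ ?_).2
  · filter_upwards [Ioo_mem_nhds h0.1 h0.2] with s hs using hmeas (hF s hs)
  · refine ContinuousOn.intervalIntegrable ?_
    rw [uIcc_of_le hab]
    exact hF 0 h0
  · exact Filter.Eventually.of_forall fun t ht s hs =>
      hC (s, t) ⟨Ioo_subset_Icc_self hs, huIoc ht⟩
  · exact intervalIntegrable_const
  · exact Filter.Eventually.of_forall fun t ht s hs =>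
      hc.hasDerivAt_lagrangian hL ⟨by linarith [hs.1], by linarith [hs.2]⟩ (huIoc ht)

theorem IsLagrangian.dL_eq_fderiv_coordLagrangian (hL : IsLagrangian U L)
    (hφ : φ ∈ IsManifold.maximalAtlas 𝓘(ℝ, E) ∞ M) {t : ℝ} {v : TangentBundle 𝓘(ℝ, E) M}
    (hv : v.proj ∈ φ.source) (hU : (t, v) ∈ U) (ζ : E × E) :
    (dL L t v ζ : ℝ) = fderiv ℝ (coordLagrangian φ L t) (tangentCoord φ v)
      (mfderiv 𝓘(ℝ, E).tangent 𝓘(ℝ, E × E) (tangentCoord φ) v ζ : E × E) := by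
  have hTR := tangentParam_tangentCoord hφ hv
  have h1 := (mdifferentiableAt_iff_differentiableAt.2
    (hL.differentiableAt_coordLagrangian (t := t) hφ (z := tangentCoord φ v) (φ.map_source hv)
      (by rw [hTR]; exact hU))).hasMFDerivAt.comp v (mdifferentiableAt_tangentCoord hφ hv).hasMFDerivAt
  have h2 : (fun v => L (t, v)) =ᶠ[𝓝 v] coordLagrangian φ L t ∘ tangentCoord φ := by
    filter_upwards [(φ.open_source.preimage (FiberBundle.continuous_proj E
      (TangentSpace 𝓘(ℝ, E) (M := M)))).mem_nhds hv] with v' hv'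
    exact congrArg (fun v => L (t, v)) (tangentParam_tangentCoord hφ hv').symm
  have h3 := (h1.congr_of_eventuallyEq h2).mfderiv
  rw [mfderiv_eq_fderiv] at h3
  exact DFunLike.congr_fun h3 ζ

theorem IsVariation.hasDerivAt_tangentCoord (hc : IsVariation U P Q a b γ ε c)
    (hφ : φ ∈ IsManifold.maximalAtlas 𝓘(ℝ, E) ∞ M) {s t : ℝ} (hs : s ∈ Ioo (-ε) ε)
    (ht : t ∈ Icc a b) (hst : c s t ∈ φ.source) :
    HasDerivAt (fun s => tangentCoord φ (velocity (E := E) a b (c s) t))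
      (mfderiv 𝓘(ℝ, E).tangent 𝓘(ℝ, E × E) (tangentCoord φ) (velocity a b (c s) t)
        (velocityDeriv a b c s t) : E × E) s := by
  have h1 := (mdifferentiableAt_tangentCoord hφ (v := velocity a b (c s) t) hst).hasMFDerivAt.comp s
    (hc.mdifferentiableAt s hs t ht).hasMFDerivAt
  have h2 : ∀ (A : E × E →L[ℝ] E × E) (B : ℝ →L[ℝ] E × E),
    HasFDerivAt (fun s => tangentCoord φ (velocity (E := E) a b (c s) t)) (A.comp B) s →
    HasDerivAt (fun s => tangentCoord φ (velocity (E := E) a b (c s) t)) (A (B 1)) s :=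
    fun A B h => h.hasDerivAt
  exact h2 _ _ (hasMFDerivAt_iff_hasFDerivAt.1 h1)

theorem IsVariation.continuousOn_tangentCoord_deriv (hc : IsVariation U P Q a b γ ε c)
    (hφ : φ ∈ IsManifold.maximalAtlas 𝓘(ℝ, E) ∞ M) :
    ContinuousOn (fun x : ℝ × ℝ => (mfderiv 𝓘(ℝ, E).tangent 𝓘(ℝ, E × E) (tangentCoord φ)
      (velocity a b (c x.1) x.2) (velocityDeriv a b c x.1 x.2) : E × E))
      ((Ioo (-ε) ε ×ˢ Icc a b) ∩ {x : ℝ × ℝ | c x.1 x.2 ∈ φ.source}) := by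
  have hopen : IsOpen (TotalSpace.proj ⁻¹' φ.source : Set (TangentBundle 𝓘(ℝ, E) M)) :=
    φ.open_source.preimage (FiberBundle.continuous_proj _ _)
  have h1 := (contMDiffOn_tangentCoord hφ).continuousOn_tangentMapWithin (by simp)
    hopen.uniqueMDiffOn
  have h2 : Continuous (fun v : TangentBundle 𝓘(ℝ, E × E) (E × E) => (v.2 : E × E)) :=
    continuous_snd.comp (tangentBundleModelSpaceHomeomorph 𝓘(ℝ, E × E)).continuous
  refine ((h2.comp_continuousOn h1).comp (hc.continuousOn_deriv.mono inter_subset_left)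
    fun x hx => hx.2).congr fun x hx => ?_
  have : mfderivWithin 𝓘(ℝ, E).tangent 𝓘(ℝ, E × E) (tangentCoord φ)
      (TotalSpace.proj ⁻¹' φ.source) (velocity a b (c x.1) x.2) =
      mfderiv 𝓘(ℝ, E).tangent 𝓘(ℝ, E × E) (tangentCoord φ) (velocity a b (c x.1) x.2) :=
    mfderivWithin_of_isOpen hopen hx.2
  simp only [Function.comp, tangentMapWithin, this]
  rfl

end

/-! ### The first variation formula -/

section

variable {E : Type*} [NormedAddCommGroup E] [NormedSpace ℝ E]
  {M : Type*} [TopologicalSpace M] [ChartedSpace E M] [IsManifold 𝓘(ℝ, E) ∞ M]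
  {φ : OpenPartialHomeomorph M E}
variable {U : Set (ℝ × TangentBundle 𝓘(ℝ, E) M)} {L : ℝ × TangentBundle 𝓘(ℝ, E) M → ℝ}
  {P Q : Set M} {a b ε : ℝ} {γ : ℝ → M} {c : ℝ → ℝ → M}

/-- The Euler-Lagrange equation in a chart `φ` at the time `t`: the momentum `p = ∂L/∂w` along
the curve has the derivative `∂L/∂q`. -/
def EulerLagrangeAt (L : ℝ × TangentBundle 𝓘(ℝ, E) M → ℝ) (a b : ℝ) (γ : ℝ → M)
    (φ : OpenPartialHomeomorph M E) (t : ℝ) : Prop :=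
  HasDerivWithinAt (fun τ => (cotangentCoord φ (FL L τ (velocity a b γ τ))).2)
    ((fderiv ℝ (coordLagrangian φ L t) (tangentCoord φ (velocity a b γ t))).comp
      (ContinuousLinearMap.inl ℝ E E)) (Icc a b) t

theorem IsVariation.velocity_zero (hc : IsVariation U P Q a b γ ε c) {t : ℝ} (ht : t ∈ Icc a b) :
    velocity (E := E) a b (c 0) t = velocity a b γ t :=
  velocity_congr (Filter.eventually_of_mem self_mem_nhdsWithin hc.base) ht

theorem IsVariation.mdifferentiableAt_curve (hc : IsVariation U P Q a b γ ε c) {s t : ℝ}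
    (hs : s ∈ Ioo (-ε) ε) (ht : t ∈ Icc a b) :
    MDifferentiableAt 𝓘(ℝ, ℝ) 𝓘(ℝ, E) (fun s => c s t) s :=
  MDifferentiableAt.comp (g := fun v : TangentBundle 𝓘(ℝ, E) M => v.proj)
    (f := fun s => velocity (E := E) a b (c s) t) s
    ((Bundle.contMDiffAt_proj (n := 1) _).mdifferentiableAt (by simp))
    (hc.mdifferentiableAt s hs t ht)

/-- The value at the time `t` of the vector field along a curve that is the derivative at `s = 0`
of a variation. -/
def variationField (c : ℝ → ℝ → M) (t : ℝ) : E :=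
  mfderiv 𝓘(ℝ, ℝ) 𝓘(ℝ, E) (fun s => c s t) 0 (1 : ℝ)

theorem IsVariation.hasDerivAt_chart (hc : IsVariation U P Q a b γ ε c) (hε : 0 < ε)
    (hφ : φ ∈ IsManifold.maximalAtlas 𝓘(ℝ, E) ∞ M) {t : ℝ}
    (ht : t ∈ Icc a b) (h0t : c 0 t ∈ φ.source) :
    HasDerivAt (fun s => φ (c s t))
      (mfderiv 𝓘(ℝ, E) 𝓘(ℝ, E) φ (c 0 t) (variationField (E := E) c t) : E) 0 := by
  have h1 := ((mdifferentiable_of_mem_maximalAtlas hφ).mdifferentiableAt h0t).hasMFDerivAt.comp 0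
    (hc.mdifferentiableAt_curve ⟨by linarith, hε⟩ ht).hasMFDerivAt
  have h2 : ∀ (A : E →L[ℝ] E) (B : ℝ →L[ℝ] E), HasFDerivAt (fun s => φ (c s t)) (A.comp B) 0 →
    HasDerivAt (fun s => φ (c s t)) (A (B 1)) 0 := fun A B h => h.hasDerivAt
  exact h2 _ _ (hasMFDerivAt_iff_hasFDerivAt.1 h1)

/-- In a chart `(p ξ)' = p' ξ + p ξ' = ∂ℓ/∂q ξ + ∂ℓ/∂w ξ'`, which is `dL` on the `s`-derivative of
the velocity. The conclusion does not mention the chart, so different times may use different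
charts. -/
theorem IsVariation.hasDerivWithinAt_pairing (hL : IsLagrangian U L)
    (hc : IsVariation U P Q a b γ ε c) (hε : 0 < ε) {t₀ : ℝ} (ht₀ : t₀ ∈ Icc a b)
    (hφ : φ ∈ IsManifold.maximalAtlas 𝓘(ℝ, E) ∞ M) (hsrc : γ t₀ ∈ φ.source)
    (hEL : EulerLagrangeAt L a b γ φ t₀) :
    HasDerivWithinAt (fun t => (((FL L t (velocity a b γ t)).2 : E →L[ℝ] ℝ) (variationField (E := E) c t)))
      (dL L t₀ (velocity a b (c 0) t₀) (velocityDeriv a b c 0 t₀)) (Icc a b) t₀ := by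
  have h0 : (0 : ℝ) ∈ Ioo (-ε) ε := ⟨by linarith, hε⟩
  have hc0 : c 0 t₀ ∈ φ.source := by rw [hc.base t₀ ht₀]; exact hsrc
  have hproj : ContinuousOn (fun x : ℝ × ℝ => c x.1 x.2) (Ioo (-ε) ε ×ˢ Icc a b) :=
    (FiberBundle.continuous_proj E _).comp_continuousOn hc.continuousOn_velocity
  -- A rectangle around `(0, t₀)` on which the whole variation stays in the domain of `φ`.
  obtain ⟨δ, hδ, hδs⟩ : ∃ δ > 0, ∀ s t, s ∈ Ioo (-ε) ε → t ∈ Icc a b → |s| < δ → |t - t₀| < δ →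
      c s t ∈ φ.source := by
    have h1 : (fun x : ℝ × ℝ => c x.1 x.2) ⁻¹' φ.source ∈ 𝓝[Ioo (-ε) ε ×ˢ Icc a b] (0, t₀) := (hproj (0, t₀) ⟨h0, ht₀⟩).preimage_mem_nhdsWithin (φ.open_source.mem_nhds hc0)
    obtain ⟨δ, hδ, h2⟩ := Metric.mem_nhdsWithin_iff.1 h1
    refine ⟨δ, hδ, fun s t hs ht hsδ htδ => @h2 (s, t) ⟨?_, hs, ht⟩⟩
    rw [Metric.mem_ball, Prod.dist_eq]
    exact max_lt (by simpa using hsδ) htδ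
  set S := Icc a b ∩ Metric.ball t₀ δ with hSdef
  have hSn : S ∈ 𝓝[Icc a b] t₀ := inter_mem_nhdsWithin _ (Metric.ball_mem_nhds t₀ hδ)
  have hmin : 0 < min ε δ := lt_min hε hδ
  have hIoo : ∀ s ∈ Ioo (-min ε δ) (min ε δ), s ∈ Ioo (-ε) ε ∧ |s| < δ := fun σ hσ =>
      ⟨⟨by linarith [hσ.1, min_le_left ε δ], by linarith [hσ.2, min_le_left ε δ]⟩,
        abs_lt.2 ⟨by linarith [hσ.1, min_le_right ε δ], by linarith [hσ.2, min_le_right ε δ]⟩⟩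
  have hsource : ∀ s ∈ Ioo (-min ε δ) (min ε δ), ∀ t ∈ S, c s t ∈ φ.source := fun s hs t ht =>
    hδs s t (hIoo s hs).1 ht.1 (hIoo s hs).2 ht.2
  have h0' : (0 : ℝ) ∈ Ioo (-min ε δ) (min ε δ) := ⟨neg_lt_zero.2 hmin, hmin⟩
  -- The `s`-derivative of the coordinates `(q, w)` of the velocity. Its first component at `s = 0`
  -- is `ξ`; `hmix` shows that the second is `ξ'`.
  let ζ : ℝ → ℝ → E × E := fun s t => (mfderiv 𝓘(ℝ, E).tangent 𝓘(ℝ, E × E) (tangentCoord φ)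
    (velocity a b (c s) t) (velocityDeriv a b c s t) : E × E)
  have hζ : ∀ s ∈ Ioo (-min ε δ) (min ε δ), ∀ t ∈ S,
      HasDerivAt (fun s => tangentCoord φ (velocity (E := E) a b (c s) t)) (ζ s t) s :=
    fun s hs t ht => hc.hasDerivAt_tangentCoord hφ (hIoo s hs).1 ht.1 (hsource s hs t ht)
  have hmix : HasDerivWithinAt (fun t => (ζ 0 t).1) (ζ 0 t₀).2 S t₀ := by
    refine hasDerivWithinAt_of_mixed_deriv (q := fun s t => φ (c s t))
      (w := fun s t => (tangentCoord φ (velocity (E := E) a b (c s) t)).2)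
      (β := fun s t => (ζ s t).2) hmin ((convex_Icc a b).inter (convex_ball t₀ δ))
      ⟨ht₀, Metric.mem_ball_self hδ⟩ ?_ ?_ ?_ ?_
    · intro s hs t ht
      exact (hasDerivWithinAt_chart_comp hφ
        (((hc.admissible s (hIoo s hs).1).contMDiffOn t ht.1).mdifferentiableWithinAt (by simp))
        (hsource s hs t ht)).mono inter_subset_left
    · intro t ht
      exact (hζ 0 h0' t ht).fst
    · intro s hs t ht
      exact (hζ s hs t ht).snd
    · refine ((continuous_snd.comp_continuousOn (hc.continuousOn_tangentCoord_deriv hφ)).mono ?_)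
        (0, t₀) ⟨h0', ht₀, Metric.mem_ball_self hδ⟩
      exact fun x hx => ⟨⟨(hIoo x.1 hx.1).1, hx.2.1⟩, hsource x.1 hx.1 x.2 hx.2⟩
  have hmix' := hmix.mono_of_mem_nhdsWithin hSn
  have hprod := hEL.clm_apply hmix'
  have hv0 := hc.velocity_zero ht₀
  have hU : (t₀, velocity a b γ t₀) ∈ U := by
    rw [← hv0]; exact (hc.admissible 0 h0).velocity_mem t₀ ht₀
  have hderiv : (dL L t₀ (velocity a b (c 0) t₀) (velocityDeriv a b c 0 t₀) : ℝ) =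
      (fderiv ℝ (coordLagrangian φ L t₀) (tangentCoord φ (velocity a b γ t₀))) (ζ 0 t₀) := by
    have := hL.dL_eq_fderiv_coordLagrangian hφ (v := velocity a b (c 0) t₀) hc0
      (by rw [hv0]; exact hU) (velocityDeriv a b c 0 t₀)
    rw [← hv0]
    exact this
  have hTR := tangentParam_tangentCoord hφ (v := velocity a b γ t₀) hsrc
  have hmom := congrArg Prod.snd (hL.cotangentCoord_FL hφ (t := t₀)
    (z := tangentCoord φ (velocity a b γ t₀)) (φ.map_source hsrc) (by rw [hTR]; exact hU))
  rw [hTR] at hmom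
  rw [hderiv]
  have hfun : ∀ t ∈ S, ((FL L t (velocity a b γ t)).2 : E →L[ℝ] ℝ) (variationField (E := E) c t) =
      (cotangentCoord φ (FL L t (velocity a b γ t))).2 (ζ 0 t).1 := by
    intro t ht
    have hγt : γ t ∈ φ.source := by rw [← hc.base t ht.1]; exact hsource 0 h0' t ht
    have h1 := (hc.hasDerivAt_chart hε hφ ht.1 (hsource 0 h0' t ht)).unique (hζ 0 h0' t ht).fst
    rw [hc.base t ht.1] at h1
    rw [← h1]
    have h2 := DFunLike.congr_fun ((mdifferentiable_of_mem_maximalAtlas hφ).symm_comp_deriv hγt)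
      (variationField (E := E) c t)
    exact (congrArg (((FL L t (velocity a b γ t)).2 : E →L[ℝ] ℝ)) h2).symm
  refine (hprod.congr_of_eventuallyEq (Filter.eventually_of_mem hSn hfun)
    (hfun t₀ ⟨ht₀, Metric.mem_ball_self hδ⟩)).congr_deriv ?_
  rw [hmom]
  simp only [ContinuousLinearMap.comp_apply, ContinuousLinearMap.inl_apply,
    ContinuousLinearMap.inr_apply]
  rw [← map_add]
  simp

/-- The first variation formula along a solution of the Euler-Lagrange equations. -/
theorem IsVariation.hasDerivAt_action_of_eulerLagrange (hL : IsLagrangian U L) (hab : a ≤ b)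
    (hc : IsVariation U P Q a b γ ε c) (hε : 0 < ε)
    (hEL : ∀ t ∈ Icc a b, ∃ φ ∈ IsManifold.maximalAtlas 𝓘(ℝ, E) ∞ M, γ t ∈ φ.source ∧
      EulerLagrangeAt L a b γ φ t) :
    HasDerivAt (fun s => action L a b (c s))
      ((((FL L b (velocity a b γ b)).2 : E →L[ℝ] ℝ) (variationField (E := E) c b)) -
      (((FL L a (velocity a b γ a)).2 : E →L[ℝ] ℝ) (variationField (E := E) c a))) 0 := by
  refine (hc.hasDerivAt_action hL hab hε).congr_deriv ?_
  have hd : ∀ t ∈ Icc a b, HasDerivWithinAt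
      (fun t => (((FL L t (velocity a b γ t)).2 : E →L[ℝ] ℝ) (variationField (E := E) c t)))
      (dL L t (velocity a b (c 0) t) (velocityDeriv a b c 0 t)) (Icc a b) t := fun t ht => by
    obtain ⟨φ, hφ, hsrc, h⟩ := hEL t ht
    exact hc.hasDerivWithinAt_pairing hL hε ht hφ hsrc h
  refine intervalIntegral.integral_eq_sub_of_hasDerivAt_of_le hab
    (fun t ht => (hd t ht).continuousWithinAt)
    (fun t ht => (hd t (Ioo_subset_Icc_self ht)).hasDerivAt (Icc_mem_nhds ht.1 ht.2)) ?_
  refine ContinuousOn.intervalIntegrable ?_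
  rw [uIcc_of_le hab]
  exact (hc.continuousOn_dL hL).comp (continuousOn_const.prodMk continuousOn_id)
    fun t ht => ⟨⟨by linarith, hε⟩, ht⟩

end

/-! ### Hamiltonian lifts -/

section

variable {E : Type*} [NormedAddCommGroup E] [NormedSpace ℝ E]
  {M : Type*} [TopologicalSpace M] [ChartedSpace E M] [IsManifold 𝓘(ℝ, E) ∞ M]
  {φ : OpenPartialHomeomorph M E}
local notation "J" => ModelWithCorners.prod 𝓘(ℝ, E) 𝓘(ℝ, E →L[ℝ] ℝ)
variable {U : Set (ℝ × TangentBundle 𝓘(ℝ, E) M)} {L : ℝ × TangentBundle 𝓘(ℝ, E) M → ℝ}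
  {P Q : Set M} {a b ε : ℝ} {γ : ℝ → M} {c : ℝ → ℝ → M} {Γ : ℝ → CotangentBundle 𝓘(ℝ, E) M}

theorem tangentCoord_chartAt_proj (v : TangentBundle 𝓘(ℝ, E) M) :
    tangentCoord (chartAt E v.proj) v = (chartAt E v.proj v.proj, (v.2 : E)) :=
  tangentCoord_chartAt (E := E) v.proj v.2

/-- The chart is fixed at `Γ t`, where its differential is the identity, so the velocity of `Γ` is
the derivative of its coordinates without any change of frame. -/
theorem hasDerivWithinAt_cotangentCoord {s : Set ℝ} {t : ℝ}
    (hΓ : MDifferentiableWithinAt 𝓘(ℝ, ℝ) J Γ s t) :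
    HasDerivWithinAt (fun τ => cotangentCoord (chartAt E (Γ t).proj) (Γ τ))
      (mfderivWithin 𝓘(ℝ, ℝ) J Γ s t (1 : ℝ) : E × (E →L[ℝ] ℝ)) s t := by
  have hext : HasMFDerivAt J 𝓘(ℝ, E × (E →L[ℝ] ℝ)) (extChartAt J (Γ t)) (Γ t)
      (ContinuousLinearMap.id ℝ (E × (E →L[ℝ] ℝ))) := by
    have h1 := (mdifferentiableAt_extChartAt (I := J) (mem_chart_source _ (Γ t))).hasMFDerivAt
    rwa [mfderiv_extChartAt_self] at h1
  have h1 := hext.comp_hasMFDerivWithinAt t hΓ.hasMFDerivWithinAt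
  have h2 : ∀ (A : ℝ →L[ℝ] E × (E →L[ℝ] ℝ)),
      HasFDerivWithinAt (extChartAt J (Γ t) ∘ Γ) A s t →
      HasDerivWithinAt (extChartAt J (Γ t) ∘ Γ) (A 1) s t := fun A h => h.hasDerivWithinAt
  have h3 := h2 _ (hasMFDerivWithinAt_iff_hasFDerivWithinAt.1 h1)
  refine h3.congr_of_eventuallyEq ?_
    (extChartAt_cotangentBundle (p := Γ t) (Γ t) (mem_chart_source _ _)).symm
  have h4 : ContinuousWithinAt (fun τ => (Γ τ).proj) s t :=
    (FiberBundle.continuous_proj (E →L[ℝ] ℝ) _).continuousAt.comp_continuousWithinAt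
      hΓ.continuousWithinAt
  filter_upwards [h4.preimage_mem_nhdsWithin
    ((chartAt E (Γ t).proj).open_source.mem_nhds (mem_chart_source E (Γ t).proj))] with τ hτ
  exact (extChartAt_cotangentBundle (p := Γ τ) (Γ t) hτ).symm

/-- As `Γ t` lies in the image of `FL`, it is `FL L t ⟨γ t, w⟩` for some `w`. The first Hamilton
equation forces `w` to be the velocity of `γ`, and then the second is the Euler-Lagrange equation.
-/
theorem IsHamiltonianLift.eq_FL_and_eulerLagrangeAt [FiniteDimensional ℝ E]
    (hL : IsLagrangian U L) (hreg : IsHyperRegular U L) (hab : a < b)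
    (hγ : IsAdmissible U P Q a b γ)
    (hΓ : IsHamiltonianLift (imageFL U L) (legendre U L) a b γ Γ) :
    (∀ t ∈ Icc a b, Γ t = FL L t (velocity a b γ t)) ∧
      ∀ t ∈ Icc a b, EulerLagrangeAt L a b γ (chartAt E (γ t)) t := by
  have key : ∀ t ∈ Icc a b, Γ t = FL L t (velocity a b γ t) ∧
      HasDerivWithinAt (fun τ => (cotangentCoord (chartAt E (γ t)) (Γ τ)).2)
        ((fderiv ℝ (coordLagrangian (chartAt E (γ t)) L t)
          (tangentCoord (chartAt E (γ t)) (velocity a b γ t))).comp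
        (ContinuousLinearMap.inl ℝ E E)) (Icc a b) t := by
    intro t ht
    obtain ⟨⟨t', m, w⟩, hU, heq⟩ := hΓ.mem t ht
    obtain rfl : t' = t := congrArg Prod.fst heq
    have hFL : FL L t' ⟨m, w⟩ = Γ t' := congrArg Prod.snd heq
    obtain rfl : m = γ t' := by rw [← hΓ.proj_eq t' ht, ← hFL]; rfl
    have hd := hasDerivWithinAt_cotangentCoord
      ((hΓ.contMDiffOn t' ht).mdifferentiableWithinAt (by simp))
    have hH := hΓ.hamilton t' ht
    generalize (mfderivWithin 𝓘(ℝ, ℝ) J Γ (Icc a b) t' (1 : ℝ) : E × (E →L[ℝ] ℝ)) = ζ at hd hH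
    rw [hΓ.proj_eq t' ht] at hd
    rw [← hFL] at hH
    obtain ⟨h1, h2⟩ := (isHamiltonianVector_FL_iff hL hreg (m := γ t') (w := w) hU ζ).1 hH
    have hφ := IsManifold.chart_mem_maximalAtlas (I := 𝓘(ℝ, E)) (n := ∞) (γ t')
    have hv := hasDerivWithinAt_chart_comp hφ
      ((hγ.contMDiffOn t' ht).mdifferentiableWithinAt (by simp)) (mem_chart_source E (γ t'))
    have hd1 : HasDerivWithinAt (fun τ => (cotangentCoord (chartAt E (γ t')) (Γ τ)).1) ζ.1
      (Icc a b) t' := hd.fst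
    have hd2 : HasDerivWithinAt (fun τ => (cotangentCoord (chartAt E (γ t')) (Γ τ)).2) ζ.2
      (Icc a b) t' := hd.snd
    have hv' : HasDerivWithinAt (chartAt E (γ t') ∘ γ) ζ.1 (Icc a b) t' :=
      hd1.congr (fun τ hτ => congrArg (chartAt E (γ t')) (hΓ.proj_eq τ hτ).symm)
        (congrArg (chartAt E (γ t')) (hΓ.proj_eq t' ht).symm)
    have hvel : (tangentCoord (chartAt E (γ t')) (velocity (E := E) a b γ t')).2 = w := by
      rw [← h1]
      exact (uniqueDiffOn_Icc hab t' ht).eq_deriv _ hv hv'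
    have hvel' : velocity (E := E) a b γ t' = ⟨γ t', w⟩ := by
      have h4 := (congrArg Prod.snd (tangentCoord_chartAt_proj (velocity a b γ t'))).symm.trans hvel
      exact TotalSpace.ext rfl (heq_of_eq h4)
    rw [hvel']
    refine ⟨hFL.symm, hd2.congr_deriv ?_⟩
    exact h2.trans (congrArg (fun z => (fderiv ℝ (coordLagrangian (chartAt E (γ t')) L t') z).comp
      (ContinuousLinearMap.inl ℝ E E)) (tangentCoord_chartAt (E := E) (γ t') w).symm)
  refine ⟨fun t ht => (key t ht).1, fun t ht => (key t ht).2.congr (fun τ hτ => ?_) ?_⟩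
  · rw [(key τ hτ).1]
  · rw [(key t ht).1]

/-- The `s`-derivative of `φ (c s t)` is the first component of that of the velocity coordinates,
hence continuous in `s`. This supplies the `C¹` curve that `IsTangentTo` asks for. -/
theorem IsVariation.contMDiffAt_curve (hc : IsVariation U P Q a b γ ε c) (hε : 0 < ε) {t : ℝ}
    (ht : t ∈ Icc a b) : ContMDiffAt 𝓘(ℝ, ℝ) 𝓘(ℝ, E) 1 (fun s => c s t) 0 := by
  have h0 : (0 : ℝ) ∈ Ioo (-ε) ε := ⟨by linarith, hε⟩
  have hφ := IsManifold.chart_mem_maximalAtlas (I := 𝓘(ℝ, E)) (n := ∞) (c 0 t)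
  set φ := chartAt E (c 0 t)
  have hsrc : c 0 t ∈ φ.source := mem_chart_source E _
  have hcont : ContinuousOn (fun s => c s t) (Ioo (-ε) ε) := fun s hs =>
    (hc.mdifferentiableAt_curve hs ht).continuousAt.continuousWithinAt
  have hu : Ioo (-ε) ε ∩ (fun s => c s t) ⁻¹' φ.source ∈ 𝓝 (0 : ℝ) :=
    (hcont.isOpen_inter_preimage isOpen_Ioo φ.open_source).mem_nhds ⟨h0, hsrc⟩
  have h1 : ContDiffAt ℝ 1 (fun s => φ (c s t)) 0 := by
    rw [contDiffAt_one_iff]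
    refine ⟨fun s => ContinuousLinearMap.toSpanSingleton ℝ
      (mfderiv 𝓘(ℝ, E).tangent 𝓘(ℝ, E × E) (tangentCoord φ) (velocity a b (c s) t)
        (velocityDeriv a b c s t) : E × E).1, _, hu, ?_, fun s hs => ?_⟩
    · have h2 := (hc.continuousOn_tangentCoord_deriv hφ).comp
        (continuousOn_id.prodMk continuousOn_const :
          ContinuousOn (fun s : ℝ => (s, t)) (Ioo (-ε) ε ∩ (fun s => c s t) ⁻¹' φ.source))
        fun s hs => ⟨⟨hs.1, ht⟩, hs.2⟩
      exact (ContinuousLinearMap.toSpanSingletonCLE (𝕜 := ℝ) (E := E)).continuous.comp_continuousOn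
        (continuous_fst.comp_continuousOn h2)
    · have h3 : HasDerivAt (fun s => φ (c s t)) _ s :=
        (hc.hasDerivAt_tangentCoord hφ hs.1 ht hs.2).fst
      exact h3.hasFDerivAt
  have h2 := ((contMDiffOn_symm_of_mem_maximalAtlas hφ).contMDiffAt
    (φ.open_target.mem_nhds (φ.map_source hsrc))).of_le (show (1 : WithTop ℕ∞) ≤ ∞ by simp)
  refine (ContMDiffAt.comp (0 : ℝ) (f := fun s => φ (c s t)) h2 h1.contMDiffAt).congr_of_eventuallyEq ?_
  filter_upwards [hu] with s hs
  exact (φ.left_inv hs.2).symm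

theorem IsVariation.isTangentTo (hc : IsVariation U P Q a b γ ε c) (hε : 0 < ε) {t : ℝ}
    (ht : t ∈ Icc a b) {R : Set M} (hR : ∀ s ∈ Ioo (-ε) ε, c s t ∈ R) :
    IsTangentTo R (γ t) (variationField (E := E) c t) :=
  ⟨fun s => c s t, hc.base t ht,
    Filter.eventually_of_mem (Ioo_mem_nhds (neg_lt_zero.2 hε) hε) hR, hc.contMDiffAt_curve hε ht, rfl⟩

theorem IsHamiltonianLift.isCriticalPoint [FiniteDimensional ℝ E]
    (hL : IsLagrangian U L) (hreg : IsHyperRegular U L) (hab : a < b)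
    (hγ : IsAdmissible U P Q a b γ)
    (hΓ : IsHamiltonianLift (imageFL U L) (legendre U L) a b γ Γ)
    (hP : Annihilates (Γ a) P) (hQ : Annihilates (Γ b) Q) : IsCriticalPoint U L P Q a b γ := by
  obtain ⟨h1, h2⟩ := hΓ.eq_FL_and_eulerLagrangeAt hL hreg hab hγ
  refine ⟨hγ, fun ε hε c hc => ?_⟩
  have ha := left_mem_Icc.2 hab.le
  have hb := right_mem_Icc.2 hab.le
  rw [h1 a ha] at hP
  rw [h1 b hb] at hQ
  refine (hc.hasDerivAt_action_of_eulerLagrange hL hab.le hε fun t ht =>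
    ⟨_, IsManifold.chart_mem_maximalAtlas (γ t), mem_chart_source E (γ t), h2 t ht⟩).congr_deriv ?_
  have h3 := hP (variationField (E := E) c a)
    (hc.isTangentTo hε ha fun s hs => (hc.admissible s hs).start_mem)
  have h4 := hQ (variationField (E := E) c b)
    (hc.isTangentTo hε hb fun s hs => (hc.admissible s hs).end_mem)
  exact (congrArg₂ (· - ·) h4 h3).trans (sub_zero 0)

theorem IsAdmissible.continuousOn_velocity (hab : a < b) (hγ : IsAdmissible U P Q a b γ) :
    ContinuousOn (velocity (E := E) a b γ) (Icc a b) := by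
  have h1 := hγ.contMDiffOn.continuousOn_tangentMapWithin (by simp)
    (uniqueDiffOn_Icc hab).uniqueMDiffOn
  have h2 : Continuous (fun t : ℝ => (⟨t, (1 : ℝ)⟩ : TangentBundle 𝓘(ℝ, ℝ) ℝ)) :=
    (tangentBundleModelSpaceHomeomorph 𝓘(ℝ, ℝ)).symm.continuous.comp
      (continuous_id.prodMk continuous_const)
  exact h1.comp h2.continuousOn fun t ht => ht

theorem IsAdmissible.continuousOn_fderiv_coordLagrangian [FiniteDimensional ℝ E]
    (hL : IsLagrangian U L) (hab : a < b)
    (hγ : IsAdmissible U P Q a b γ) (hφ : φ ∈ IsManifold.maximalAtlas 𝓘(ℝ, E) ∞ M) :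
    ContinuousOn (fun t => fderiv ℝ (coordLagrangian φ L t) (tangentCoord φ (velocity a b γ t)))
      (Icc a b ∩ γ ⁻¹' φ.source) := by
  refine (hL.continuousOn_fderiv_coordLagrangian hφ).comp (continuousOn_id.prodMk
    ((contMDiffOn_tangentCoord hφ).continuousOn.comp
      ((hγ.continuousOn_velocity hab).mono inter_subset_left) fun t ht => ht.2)) ?_
  intro t ht
  refine ⟨φ.map_source ht.2, ?_⟩
  have h := tangentParam_tangentCoord hφ (v := velocity a b γ t) ht.2
  exact (congrArg (fun v => (t, v) ∈ U) h).mpr (hγ.velocity_mem t ht.1)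

/-- `FL` is not assumed differentiable in `t`, so the regularity of the lift comes from the
equation: `p' = ∂ℓ/∂q` along the velocity of `γ`, which is continuous. -/
theorem isHamiltonianLift_of_eulerLagrange [FiniteDimensional ℝ E]
    (hL : IsLagrangian U L) (hreg : IsHyperRegular U L) (hab : a < b)
    (hγ : IsAdmissible U P Q a b γ)
    (hEL : ∀ φ ∈ IsManifold.maximalAtlas 𝓘(ℝ, E) ∞ M, ∀ t ∈ Icc a b, γ t ∈ φ.source →
      EulerLagrangeAt L a b γ φ t) :
    IsHamiltonianLift (imageFL U L) (legendre U L) a b γ (fun t => FL L t (velocity a b γ t)) := by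
  have hΓ : ContMDiffOn 𝓘(ℝ, ℝ) J 1 (fun t => FL L t (velocity a b γ t)) (Icc a b) := by
    intro t₀ ht₀
    have hφ := IsManifold.chart_mem_maximalAtlas (I := 𝓘(ℝ, E)) (n := ∞) (γ t₀)
    have hsrc := mem_chart_source E (γ t₀)
    rw [contMDiffWithinAt_totalSpace]
    refine ⟨hγ.contMDiffOn t₀ ht₀, ?_⟩
    have hu : Icc a b ∩ γ ⁻¹' (chartAt E (γ t₀)).source ∈ 𝓝[Icc a b] t₀ :=
      Filter.inter_mem self_mem_nhdsWithin ((hγ.contMDiffOn.continuousOn t₀ ht₀).preimage_mem_nhdsWithin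
        ((chartAt E (γ t₀)).open_source.mem_nhds hsrc))
    have h1 : ContDiffWithinAt ℝ 1
        (fun t => (cotangentCoord (chartAt E (γ t₀)) (FL L t (velocity a b γ t))).2)
        (Icc a b) t₀ := by
      rw [show (1 : WithTop ℕ∞) = 0 + 1 by simp, contDiffWithinAt_succ_iff_hasFDerivWithinAt (by simp)]
      refine ⟨_, by rw [insert_eq_of_mem ht₀]; exact hu, by simp, fun t =>
        ContinuousLinearMap.toSpanSingleton ℝ ((fderiv ℝ (coordLagrangian (chartAt E (γ t₀)) L t)
          (tangentCoord (chartAt E (γ t₀)) (velocity a b γ t))).comp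
          (ContinuousLinearMap.inl ℝ E E)), fun t ht => ?_, ?_⟩
      · exact ((hEL _ hφ t ht.1 ht.2).mono inter_subset_left).hasFDerivWithinAt
      · refine ContDiffOn.contDiffWithinAt (contDiffOn_zero.2 ?_) ⟨ht₀, hsrc⟩
        exact (ContinuousLinearMap.toSpanSingletonCLE (𝕜 := ℝ) (E := E →L[ℝ] ℝ)).continuous.comp_continuousOn
          ((hγ.continuousOn_fderiv_coordLagrangian hL hab hφ).clm_comp continuousOn_const)
    refine h1.contMDiffWithinAt.congr_of_eventuallyEq
      (Filter.eventually_of_mem hu fun t ht => ?_) ?_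
    · exact trivializationAt_cotangentBundle (p := FL L t (velocity a b γ t)) (γ t₀) ht.2
    · exact trivializationAt_cotangentBundle (p := FL L t₀ (velocity a b γ t₀)) (γ t₀) hsrc
  refine ⟨hΓ, fun t _ => rfl, fun t ht => ⟨(t, velocity a b γ t), hγ.velocity_mem t ht, rfl⟩,
    fun t ht => ?_⟩
  have hφ := IsManifold.chart_mem_maximalAtlas (I := 𝓘(ℝ, E)) (n := ∞) (γ t)
  have hsrc := mem_chart_source E (γ t)
  have hd := hasDerivWithinAt_cotangentCoord ((hΓ t ht).mdifferentiableWithinAt (by simp))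
  refine (isHamiltonianVector_FL_iff hL hreg (hγ.velocity_mem t ht) _).2 ⟨?_, ?_⟩
  · have hv := hasDerivWithinAt_chart_comp hφ
      ((hγ.contMDiffOn t ht).mdifferentiableWithinAt (by simp)) hsrc
    have h1 := (uniqueDiffOn_Icc hab t ht).eq_deriv _ hd.fst hv
    exact h1.trans (congrArg Prod.snd (tangentCoord_chartAt_proj (velocity a b γ t)))
  · have h1 := (uniqueDiffOn_Icc hab t ht).eq_deriv _ hd.snd (hEL _ hφ t ht hsrc)
    exact h1.trans (congrArg (fun z => (fderiv ℝ (coordLagrangian (chartAt E (γ t)) L t) z).comp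
      (ContinuousLinearMap.inl ℝ E E)) (tangentCoord_chartAt_proj (velocity a b γ t)))

end

/-! ### Variations in a chart -/

section

variable {E : Type*} [NormedAddCommGroup E] [NormedSpace ℝ E]
  {M : Type*} [TopologicalSpace M] [ChartedSpace E M] [IsManifold 𝓘(ℝ, E) ∞ M]
  {φ : OpenPartialHomeomorph M E}
variable {U : Set (ℝ × TangentBundle 𝓘(ℝ, E) M)} {L : ℝ × TangentBundle 𝓘(ℝ, E) M → ℝ}
  {P Q : Set M} {a b ε : ℝ} {γ : ℝ → M} {η θ : ℝ → E} {K : Set ℝ}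

open Classical in
/-- The family of curves that displaces `γ` by `s η` in the chart `φ`. -/
def chartVariation (φ : OpenPartialHomeomorph M E) (γ : ℝ → M) (η : ℝ → E) (s t : ℝ) : M :=
  if γ t ∈ φ.source then φ.symm (φ (γ t) + s • η t) else γ t

theorem chartVariation_of_mem {s t : ℝ} (h : γ t ∈ φ.source) :
    chartVariation φ γ η s t = φ.symm (φ (γ t) + s • η t) := if_pos h

theorem chartVariation_of_eq_zero {s t : ℝ} (h : s • η t = 0) : chartVariation φ γ η s t = γ t := by
  unfold chartVariation
  split_ifs with h1
  · rw [h, add_zero, φ.left_inv h1]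
  · rfl

theorem tangentMap_curve_congr {f g : ℝ → TangentBundle 𝓘(ℝ, E) M} {s : ℝ} (h : f =ᶠ[𝓝 s] g) :
    (⟨f s, (mfderiv 𝓘(ℝ, ℝ) 𝓘(ℝ, E).tangent f s (1 : ℝ) : E × E)⟩ :
      TangentBundle 𝓘(ℝ, E).tangent (TangentBundle 𝓘(ℝ, E) M)) =
    ⟨g s, (mfderiv 𝓘(ℝ, ℝ) 𝓘(ℝ, E).tangent g s (1 : ℝ) : E × E)⟩ := by
  have h2 : (mfderiv 𝓘(ℝ, ℝ) 𝓘(ℝ, E).tangent f s : ℝ →L[ℝ] E × E) =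
    mfderiv 𝓘(ℝ, ℝ) 𝓘(ℝ, E).tangent g s := h.mfderiv_eq
  exact TotalSpace.ext h.self_of_nhds (heq_of_eq (DFunLike.congr_fun h2 1))

theorem velocity_chartVariation (hφ : φ ∈ IsManifold.maximalAtlas 𝓘(ℝ, E) ∞ M) (hab : a < b)
    (hγ : IsAdmissible U P Q a b γ) (hη : ∀ t, HasDerivAt η (θ t) t) {s t : ℝ} (ht : t ∈ Icc a b)
    (hsrc : γ t ∈ φ.source) (htgt : φ (γ t) + s • η t ∈ φ.target) :
    velocity (E := E) a b (chartVariation φ γ η s) t =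
      tangentParam φ (tangentCoord φ (velocity a b γ t) + s • (η t, θ t)) := by
  have hx : HasDerivWithinAt (fun t => φ (γ t) + s • η t)
      ((tangentCoord φ (velocity (E := E) a b γ t)).2 + s • θ t) (Icc a b) t :=
    (hasDerivWithinAt_chart_comp hφ ((hγ.contMDiffOn t ht).mdifferentiableWithinAt (by simp))
      hsrc).add ((hη t).const_smul s).hasDerivWithinAt
  rw [← show tangentParam φ (φ (γ t) + s • η t, (tangentCoord φ (velocity (E := E) a b γ t)).2 + s • θ t)
    = tangentParam φ (tangentCoord φ (velocity a b γ t) + s • (η t, θ t)) from rfl,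
    ← velocity_chart_symm_comp hφ hab ht hx htgt]
  refine velocity_congr ?_ ht
  filter_upwards [(hγ.contMDiffOn.continuousOn t ht).preimage_mem_nhdsWithin
    (φ.open_source.mem_nhds hsrc)] with τ hτ
  exact chartVariation_of_mem hτ

theorem velocity_chartVariation_of_notMem (hK : IsClosed K) (hηK : ∀ t ∉ K, η t = 0) {s t : ℝ}
    (ht : t ∈ Icc a b) (htK : t ∉ K) :
    velocity (E := E) a b (chartVariation φ γ η s) t = velocity a b γ t := by
  refine velocity_congr ?_ ht
  filter_upwards [mem_nhdsWithin_of_mem_nhds (hK.isOpen_compl.mem_nhds htK)] with τ hτ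
  exact chartVariation_of_eq_zero (by rw [hηK τ hτ, smul_zero])

/-- The displacement vanishes off the closed set `K`, and `γ` maps `K ∩ [a, b]` into the chart.
Hence near each time either the velocity has the coordinates `z s t`, affine in `s`, or the family
does not move. `K` may contain an end point, so that displacements of the ends are covered too. -/
theorem exists_isVariation_chartVariation (hL : IsLagrangian U L)
    (hφ : φ ∈ IsManifold.maximalAtlas 𝓘(ℝ, E) ∞ M) (hab : a < b)
    (hγ : IsAdmissible U P Q a b γ) (hθ : Continuous θ) (hη : ∀ t, HasDerivAt η (θ t) t)
    (hK : IsClosed K) (hηK : ∀ t ∉ K, η t = 0) (hKφ : ∀ t ∈ Icc a b, t ∈ K → γ t ∈ φ.source)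
    (hP : ∀ᶠ s in 𝓝 0, chartVariation φ γ η s a ∈ P)
    (hQ : ∀ᶠ s in 𝓝 0, chartVariation φ γ η s b ∈ Q) :
    ∃ ε > 0, IsVariation U P Q a b γ ε (chartVariation φ γ η) ∧
      ∀ s ∈ Ioo (-ε) ε, ∀ t ∈ Icc a b, γ t ∈ φ.source →
        tangentCoord φ (velocity (E := E) a b (chartVariation φ γ η s) t) =
          tangentCoord φ (velocity a b γ t) + s • (η t, θ t) := by
  have hηc : Continuous η := continuous_iff_continuousAt.2 fun t => (hη t).continuousAt
  have hη1 : ContDiff ℝ 1 η := by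
    rw [contDiff_one_iff_deriv]
    exact ⟨fun t => (hη t).differentiableAt, by rwa [show deriv η = θ from funext fun t => (hη t).deriv]⟩
  have hθK : ∀ t ∉ K, θ t = 0 := fun t ht =>
    (hη t).unique ((hasDerivAt_const t (0 : E)).congr_of_eventuallyEq
      (Filter.eventually_of_mem (hK.isOpen_compl.mem_nhds ht) hηK))
  set A := Icc a b ∩ γ ⁻¹' φ.source with hA
  have hAn : ∀ t ∈ A, A ∈ 𝓝[Icc a b] t := fun t ht =>
    Filter.inter_mem self_mem_nhdsWithin ((hγ.contMDiffOn.continuousOn t ht.1).preimage_mem_nhdsWithin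
      (φ.open_source.mem_nhds ht.2))
  let z : ℝ → ℝ → E × E := fun s t => tangentCoord φ (velocity a b γ t) + s • (η t, θ t)
  have hzc : ContinuousOn (fun x : ℝ × ℝ => z x.1 x.2) (univ ×ˢ A) := by
    refine ContinuousOn.add ?_ (by fun_prop)
    refine ((contMDiffOn_tangentCoord hφ).continuousOn.comp
      ((hγ.continuousOn_velocity hab).mono inter_subset_left) fun t ht => ht.2).comp
      continuousOn_snd fun x hx => hx.2
  have hO := isOpen_preimage_tangentParam hφ hL.isOpen
  have hO0 : ∀ t ∈ A, (t, tangentCoord φ (velocity a b γ t)) ∈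
      {x : ℝ × E × E | x.2.1 ∈ φ.target ∧ (x.1, tangentParam φ x.2) ∈ U} := fun t ht => by
    refine ⟨φ.map_source ht.2, ?_⟩
    have h := tangentParam_tangentCoord hφ (v := velocity a b γ t) ht.2
    exact (congrArg (fun v => (t, v) ∈ U) h).mpr (hγ.velocity_mem t ht.1)
  -- The domain of admissible coordinates is open and `[a, b] ∩ K` is compact, so one bound on `s`
  -- serves all times.
  have hev : ∀ᶠ s in 𝓝 (0 : ℝ), ∀ t ∈ Icc a b ∩ K, t ∈ Icc a b → (t, z s t) ∈
      {x : ℝ × E × E | x.2.1 ∈ φ.target ∧ (x.1, tangentParam φ x.2) ∈ U} := by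
    refine (isCompact_Icc.inter_right hK).eventually_forall_of_forall_eventually fun t ht => ?_
    have htA : t ∈ A := ⟨ht.1, hKφ t ht.1 ht.2⟩
    have h1 : ContinuousWithinAt (fun x : ℝ × ℝ => (x.2, z x.1 x.2)) (univ ×ˢ Icc a b) (0, t) := by
      refine ((continuousOn_snd.prodMk hzc) (0, t) ⟨mem_univ _, htA⟩).mono_of_mem_nhdsWithin ?_
      rw [nhdsWithin_prod_eq]
      exact Filter.prod_mem_prod self_mem_nhdsWithin (hAn t htA)
    have h2 : (t, z 0 t) ∈
      {x : ℝ × E × E | x.2.1 ∈ φ.target ∧ (x.1, tangentParam φ x.2) ∈ U} := by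
      simpa only [z, zero_smul, add_zero] using hO0 t htA
    filter_upwards [eventually_nhdsWithin_iff.1 (h1.preimage_mem_nhdsWithin (hO.mem_nhds h2))]
      with x hx hx'
    exact hx ⟨mem_univ _, hx'⟩
  obtain ⟨ε, hε, hεs⟩ := Metric.eventually_nhds_iff.1 (hev.and (hP.and hQ))
  have hεs' : ∀ s ∈ Ioo (-ε) ε, dist s 0 < ε := fun s hs => by
    simpa using abs_lt.2 ⟨hs.1, hs.2⟩
  have hzO : ∀ s ∈ Ioo (-ε) ε, ∀ t ∈ A, (t, z s t) ∈
      {x : ℝ × E × E | x.2.1 ∈ φ.target ∧ (x.1, tangentParam φ x.2) ∈ U} := by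
    intro s hs t ht
    by_cases htK : t ∈ K
    · exact (hεs (hεs' s hs)).1 t ⟨ht.1, htK⟩ ht.1
    · have : z s t = tangentCoord φ (velocity a b γ t) := by
        simp [z, hηK t htK, hθK t htK]
      rw [this]
      exact hO0 t ht
  have hvel : ∀ s ∈ Ioo (-ε) ε, ∀ t ∈ A,
      velocity (E := E) a b (chartVariation φ γ η s) t = tangentParam φ (z s t) := fun s hs t ht =>
    velocity_chartVariation hφ hab hγ hη ht.1 ht.2 (hzO s hs t ht).1
  have hcases : ∀ t ∈ Icc a b, t ∈ A ∨ t ∉ K := fun t ht => by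
    by_cases htK : t ∈ K
    · exact Or.inl ⟨ht, hKφ t ht htK⟩
    · exact Or.inr htK
  have hvelA : ∀ s ∈ Ioo (-ε) ε, ∀ t ∈ A,
      (fun s => velocity (E := E) a b (chartVariation φ γ η s) t) =ᶠ[𝓝 s]
        tangentParam φ ∘ fun s => z s t := fun s hs t ht => by
    filter_upwards [Ioo_mem_nhds hs.1 hs.2] with σ hσ using hvel σ hσ t ht
  have hz' : ∀ s t, HasDerivAt (fun s => z s t) (η t, θ t) s := fun s t => by
    have h := ((hasDerivAt_id s).smul_const ((η t, θ t) : E × E)).const_add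
      (tangentCoord φ (velocity a b γ t))
    rw [one_smul] at h
    exact h
  have hTz : ∀ s ∈ Ioo (-ε) ε, ∀ t ∈ A, HasMFDerivAt 𝓘(ℝ, ℝ) 𝓘(ℝ, E).tangent
      (tangentParam φ ∘ fun s => z s t) s
      ((mfderiv 𝓘(ℝ, E × E) 𝓘(ℝ, E).tangent (tangentParam φ) (z s t)).comp
        (ContinuousLinearMap.toSpanSingleton ℝ (η t, θ t))) := fun s hs t ht =>
    (mdifferentiableAt_tangentParam hφ (hzO s hs t ht).1).hasMFDerivAt.comp s
      (hasMFDerivAt_iff_hasFDerivAt.2 (hz' s t).hasFDerivAt)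
  have hconst : ∀ s t, t ∈ Icc a b → t ∉ K →
      (fun s => velocity (E := E) a b (chartVariation φ γ η s) t) =ᶠ[𝓝 s]
        fun _ => velocity a b γ t := fun s t ht htK =>
    Filter.Eventually.of_forall fun σ => velocity_chartVariation_of_notMem hK hηK ht htK
  refine ⟨ε, hε, ⟨?_, ?_, ?_, ?_⟩, ?_⟩
  · exact fun t _ => chartVariation_of_eq_zero (zero_smul ℝ _)
  · refine fun s hs => ⟨?_, (hεs (hεs' s hs)).2.1, (hεs (hεs' s hs)).2.2, ?_⟩
    · intro t ht
      rcases hcases t ht with htA | htK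
      · have h1 : ContMDiffWithinAt 𝓘(ℝ, ℝ) 𝓘(ℝ, E) 1 (fun t => φ (γ t)) (Icc a b) t :=
          (((contMDiffOn_of_mem_maximalAtlas hφ).contMDiffAt (φ.open_source.mem_nhds htA.2)).of_le
            (show (1 : WithTop ℕ∞) ≤ ∞ by simp)).comp_contMDiffWithinAt t (hγ.contMDiffOn t ht)
        have h2 : ContMDiffWithinAt 𝓘(ℝ, ℝ) 𝓘(ℝ, E) 1 (fun t => φ (γ t) + s • η t) (Icc a b) t :=
          h1.add (hη1.const_smul s).contMDiff.contMDiffAt.contMDiffWithinAt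
        have h3 := (((contMDiffOn_symm_of_mem_maximalAtlas hφ).contMDiffAt
          (φ.open_target.mem_nhds (hzO s hs t htA).1)).of_le
            (show (1 : WithTop ℕ∞) ≤ ∞ by simp))
        refine (ContMDiffAt.comp_contMDiffWithinAt (f := fun t => φ (γ t) + s • η t)
          t h3 h2).congr_of_eventuallyEq ?_ (chartVariation_of_mem htA.2)
        filter_upwards [hAn t htA] with τ hτ using chartVariation_of_mem hτ.2
      · refine (hγ.contMDiffOn t ht).congr_of_eventuallyEq ?_
          (chartVariation_of_eq_zero (by rw [hηK t htK, smul_zero]))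
        filter_upwards [mem_nhdsWithin_of_mem_nhds (hK.isOpen_compl.mem_nhds htK)] with τ hτ
        exact chartVariation_of_eq_zero (by rw [hηK τ hτ, smul_zero])
    · intro t ht
      rcases hcases t ht with htA | htK
      · rw [hvel s hs t htA]
        exact (hzO s hs t htA).2
      · rw [velocity_chartVariation_of_notMem hK hηK ht htK]
        exact hγ.velocity_mem t ht
  · intro s hs t ht
    rcases hcases t ht with htA | htK
    · exact ((hTz s hs t htA).congr_of_eventuallyEq (hvelA s hs t htA)).mdifferentiableAt
    · exact mdifferentiableAt_const.congr_of_eventuallyEq (hconst s t ht htK)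
  · rintro ⟨s, t⟩ ⟨hs, ht⟩
    rcases hcases t ht with htA | htK
    · have h1 := continuousOn_mfderiv_tangentParam hφ (s := Ioo (-ε) ε ×ˢ A)
        (z := fun x => z x.1 x.2) (e := fun x => (η x.2, θ x.2))
        (hzc.mono (prod_mono (subset_univ _) subset_rfl)) (by fun_prop)
        fun x hx => (hzO x.1 hx.1 x.2 hx.2).1
      refine ((h1.congr fun x hx => ?_) (s, t) ⟨hs, htA⟩).mono_of_mem_nhdsWithin ?_
      · refine (tangentMap_curve_congr (hvelA x.1 hx.1 x.2 hx.2)).trans ?_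
        rw [(hTz x.1 hx.1 x.2 hx.2).mfderiv]
        refine TotalSpace.ext rfl (heq_of_eq ?_)
        change mfderiv 𝓘(ℝ, E × E) 𝓘(ℝ, E).tangent (tangentParam φ) (z x.1 x.2)
          ((1 : ℝ) • (η x.2, θ x.2) : E × E) = _
        rw [one_smul]
      · rw [nhdsWithin_prod_eq]
        exact Filter.prod_mem_prod self_mem_nhdsWithin (hAn t htA)
    · have h1 : ContinuousOn (fun x : ℝ × ℝ => (⟨velocity (E := E) a b γ x.2, (0 : E × E)⟩ :
          TangentBundle 𝓘(ℝ, E).tangent (TangentBundle 𝓘(ℝ, E) M)))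
          (Ioo (-ε) ε ×ˢ (Icc a b ∩ Kᶜ)) :=
        (contMDiff_zeroSection (IB := 𝓘(ℝ, E).tangent) (n := 0) ℝ
          (TangentSpace 𝓘(ℝ, E).tangent (M := TangentBundle 𝓘(ℝ, E) M))).continuous.comp_continuousOn
          ((hγ.continuousOn_velocity hab).comp continuousOn_snd fun x hx => hx.2.1)
      refine ((h1.congr fun x hx => ?_) (s, t) ⟨hs, ht, htK⟩).mono_of_mem_nhdsWithin ?_
      · refine (tangentMap_curve_congr (hconst x.1 x.2 hx.2.1 hx.2.2)).trans ?_
        rw [mfderiv_const]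
        rfl
      · rw [nhdsWithin_prod_eq]
        exact Filter.prod_mem_prod self_mem_nhdsWithin
          (Filter.inter_mem self_mem_nhdsWithin
            (mem_nhdsWithin_of_mem_nhds (hK.isOpen_compl.mem_nhds htK)))
  · intro s hs t ht hsrc
    rw [hvel s hs t ⟨ht, hsrc⟩]
    exact tangentCoord_tangentParam hφ (hzO s hs t ⟨ht, hsrc⟩).1

end

/-! ### Critical points -/

section

variable {E : Type*} [NormedAddCommGroup E] [NormedSpace ℝ E]
  {M : Type*} [TopologicalSpace M] [ChartedSpace E M] [IsManifold 𝓘(ℝ, E) ∞ M]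
  {φ : OpenPartialHomeomorph M E}
variable {U : Set (ℝ × TangentBundle 𝓘(ℝ, E) M)} {L : ℝ × TangentBundle 𝓘(ℝ, E) M → ℝ}
  {P Q : Set M} {a b : ℝ} {γ : ℝ → M} {η θ : ℝ → E} {K : Set ℝ}

/-- The weak form of the Euler-Lagrange equations: the velocity of the chart variation has
coordinates with `s`-derivative `(η, θ)`, which turns the derivative of the action into this
integral. -/
theorem IsCriticalPoint.integral_eq_zero (hL : IsLagrangian U L)
    (hφ : φ ∈ IsManifold.maximalAtlas 𝓘(ℝ, E) ∞ M) (hab : a < b)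
    (hγ : IsCriticalPoint U L P Q a b γ) (hθ : Continuous θ) (hη : ∀ t, HasDerivAt η (θ t) t)
    (hK : IsClosed K) (hηK : ∀ t ∉ K, η t = 0) (hKφ : ∀ t ∈ Icc a b, t ∈ K → γ t ∈ φ.source)
    (hP : ∀ᶠ s in 𝓝 0, chartVariation φ γ η s a ∈ P)
    (hQ : ∀ᶠ s in 𝓝 0, chartVariation φ γ η s b ∈ Q) :
    ∫ t in a..b, fderiv ℝ (coordLagrangian φ L t) (tangentCoord φ (velocity a b γ t)) (η t, θ t)
      = 0 := by
  obtain ⟨ε, hε, hc, hz⟩ :=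
    exists_isVariation_chartVariation hL hφ hab hγ.1 hθ hη hK hηK hKφ hP hQ
  have h0 : (0 : ℝ) ∈ Ioo (-ε) ε := ⟨by linarith, hε⟩
  rw [← (hc.hasDerivAt_action hL hab.le hε).unique (hγ.2 ε hε _ hc)]
  refine intervalIntegral.integral_congr fun t ht => ?_
  rw [uIcc_of_le hab.le] at ht
  by_cases hsrc : γ t ∈ φ.source
  · have hv0 := hc.velocity_zero ht
    have hc0 : chartVariation φ γ η 0 t ∈ φ.source := by rw [hc.base t ht]; exact hsrc
    have h1 := hL.dL_eq_fderiv_coordLagrangian hφ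
      (v := velocity a b (chartVariation φ γ η 0) t) hc0
      ((hc.admissible 0 h0).velocity_mem t ht) (velocityDeriv a b (chartVariation φ γ η) 0 t)
    have h2 := hc.hasDerivAt_tangentCoord hφ h0 ht hc0
    have h3 : HasDerivAt (fun s : ℝ => tangentCoord φ (velocity (E := E) a b γ t) +
        s • ((η t, θ t) : E × E)) (η t, θ t) 0 := by
      have h := ((hasDerivAt_id (0 : ℝ)).smul_const ((η t, θ t) : E × E)).const_add
        (tangentCoord φ (velocity a b γ t))
      rw [one_smul] at h
      exact h
    have h4 := h2.unique (h3.congr_of_eventuallyEq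
      (Filter.eventually_of_mem (Ioo_mem_nhds h0.1 h0.2) fun s hs => hz s hs t ht hsrc))
    rw [← hv0, ← h4]
    exact h1.symm
  -- Outside the chart domain the coordinate expression has no meaning, but there `η = θ = 0` and
  -- both integrands vanish.
  · have htK : t ∉ K := fun h => hsrc (hKφ t ht h)
    have hθ0 : θ t = 0 := (hη t).unique ((hasDerivAt_const t (0 : E)).congr_of_eventuallyEq
      (Filter.eventually_of_mem (hK.isOpen_compl.mem_nhds htK) hηK))
    have h1 : (fun s => velocity (E := E) a b (chartVariation φ γ η s) t) =
        fun _ => velocity a b γ t :=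
      funext fun s => velocity_chartVariation_of_notMem hK hηK ht htK
    have h2 : velocityDeriv (E := E) a b (chartVariation φ γ η) 0 t = 0 := by
      unfold velocityDeriv
      rw [h1, mfderiv_const]
      rfl
    have h3 : ∀ ζ : E × E, ζ = 0 →
        (dL L t (velocity a b (chartVariation φ γ η 0) t) ζ : ℝ) = 0 := by
      rintro ζ rfl
      exact map_zero (dL L t (velocity a b (chartVariation φ γ η 0) t))
    refine Eq.trans ?_ (h3 _ h2).symm
    rw [hηK t htK, hθ0]
    exact map_zero _

theorem IsAdmissible.cotangentCoord_FL (hL : IsLagrangian U L)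
    (hφ : φ ∈ IsManifold.maximalAtlas 𝓘(ℝ, E) ∞ M) (hγ : IsAdmissible U P Q a b γ)
    {t : ℝ} (ht : t ∈ Icc a b) (hsrc : γ t ∈ φ.source) :
    (cotangentCoord φ (FL L t (velocity a b γ t))).2 =
      (fderiv ℝ (coordLagrangian φ L t) (tangentCoord φ (velocity a b γ t))).comp
        (ContinuousLinearMap.inr ℝ E E) := by
  have hTR := tangentParam_tangentCoord hφ (v := velocity a b γ t) hsrc
  have h := congrArg Prod.snd (hL.cotangentCoord_FL hφ (t := t)
    (z := tangentCoord φ (velocity a b γ t)) (φ.map_source hsrc)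
    (by rw [hTR]; exact hγ.velocity_mem t ht))
  rwa [hTR] at h

theorem exists_Icc_subset_of_mem_nhdsWithin (hab : a < b) {t : ℝ} (ht : t ∈ Icc a b) {S : Set ℝ}
    (hS : S ∈ 𝓝[Icc a b] t) :
    ∃ α β, a ≤ α ∧ α < β ∧ β ≤ b ∧ t ∈ Icc α β ∧ Icc α β ⊆ S ∧ Icc α β ∈ 𝓝[Icc a b] t := by
  obtain ⟨δ, hδ, h⟩ := Metric.mem_nhdsWithin_iff.1 hS
  refine ⟨max a (t - δ / 2), min b (t + δ / 2), le_max_left _ _, ?_, min_le_left _ _, ?_, ?_, ?_⟩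
  · rw [max_lt_iff, lt_min_iff, lt_min_iff]
    exact ⟨⟨hab, by linarith [ht.1]⟩, by linarith [ht.2], by linarith⟩
  · exact ⟨max_le ht.1 (by linarith), le_min ht.2 (by linarith)⟩
  · refine fun τ hτ => h ⟨?_, (le_max_left _ _).trans hτ.1, hτ.2.trans (min_le_left _ _)⟩
    have h1 := (le_max_right a (t - δ / 2)).trans hτ.1
    have h2 := hτ.2.trans (min_le_right b (t + δ / 2))
    rw [Metric.mem_ball, Real.dist_eq, abs_lt]
    constructor <;> linarith
  · refine Filter.mem_of_superset (inter_mem_nhdsWithin _ (Metric.ball_mem_nhds t (half_pos hδ)))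
      fun τ hτ => ?_
    have h1 := hτ.2
    rw [Metric.mem_ball, Real.dist_eq, abs_lt] at h1
    exact ⟨max_le hτ.1.1 (by linarith), le_min hτ.1.2 (by linarith)⟩

/-- A covector in finite dimension is determined by its values on a basis. This reduces the
Euler-Lagrange equation to the scalar lemma of du Bois-Reymond, one direction `e` at a time. -/
theorem hasDerivWithinAt_dual_of_apply [FiniteDimensional ℝ E] {p : ℝ → E →L[ℝ] ℝ}
    {p' : E →L[ℝ] ℝ} {S : Set ℝ} {t : ℝ}
    (h : ∀ e, HasDerivWithinAt (fun τ => p τ e) (p' e) S t) : HasDerivWithinAt p p' S t := by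
  let B := Module.finBasis ℝ E
  let Λ := ((B.constr ℝ (M' := ℝ)).trans LinearMap.toContinuousLinearMap).toContinuousLinearEquiv
  have hΛ : ∀ q : E →L[ℝ] ℝ, Λ (fun i => q (B i)) = q := fun q =>
    ContinuousLinearMap.coe_injective (B.ext fun i => by simp [Λ])
  have h1 : HasDerivWithinAt (fun τ i => p τ (B i)) (fun i => p' (B i)) S t :=
    hasDerivWithinAt_pi.2 fun i => h (B i)
  have h2 := Λ.toContinuousLinearMap.hasFDerivAt.comp_hasDerivWithinAt t h1
  exact ((h2.congr (fun τ _ => (hΛ (p τ)).symm) (hΛ (p t)).symm)).congr_deriv (hΛ p')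

theorem integral_eq_integral_of_eq_zero {f : ℝ → ℝ} {α β : ℝ} (hα : a ≤ α) (hαβ : α ≤ β)
    (hβ : β ≤ b) (h : ∀ t ∈ Icc a b, t ∉ Icc α β → f t = 0) :
    ∫ t in a..b, f t = ∫ t in α..β, f t := by
  rw [intervalIntegral.integral_of_le (hα.trans (hαβ.trans hβ)),
    intervalIntegral.integral_of_le hαβ, ← MeasureTheory.integral_Icc_eq_integral_Ioc,
    ← MeasureTheory.integral_Icc_eq_integral_Ioc]
  exact MeasureTheory.setIntegral_eq_of_subset_of_forall_sdiff_eq_zero measurableSet_Icc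
    (Icc_subset_Icc hα hβ) fun t ht => h t ht.1 ht.2

/-- A critical point of the action satisfies the Euler-Lagrange equations in every chart. -/
theorem IsCriticalPoint.eulerLagrangeAt [FiniteDimensional ℝ E] (hL : IsLagrangian U L)
    (hab : a < b) (hγ : IsCriticalPoint U L P Q a b γ)
    (hφ : φ ∈ IsManifold.maximalAtlas 𝓘(ℝ, E) ∞ M) {t : ℝ} (ht : t ∈ Icc a b)
    (hsrc : γ t ∈ φ.source) : EulerLagrangeAt L a b γ φ t := by
  obtain ⟨α, β, hα, hαβ, hβ, htαβ, hsub, hnhds⟩ := exists_Icc_subset_of_mem_nhdsWithin hab ht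
    ((hγ.1.contMDiffOn.continuousOn t ht).preimage_mem_nhdsWithin (φ.open_source.mem_nhds hsrc))
  let D : ℝ → E × E →L[ℝ] ℝ := fun t =>
    fderiv ℝ (coordLagrangian φ L t) (tangentCoord φ (velocity a b γ t))
  have hsub' : Icc α β ⊆ Icc a b ∩ γ ⁻¹' φ.source := fun τ hτ => ⟨Icc_subset_Icc hα hβ hτ, hsub hτ⟩
  have hD : ContinuousOn D (Icc α β) :=
    (hγ.1.continuousOn_fderiv_coordLagrangian hL hab hφ).mono hsub'
  have hmain : HasDerivWithinAt (fun τ => (D τ).comp (ContinuousLinearMap.inr ℝ E E))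
      ((D t).comp (ContinuousLinearMap.inl ℝ E E)) (Icc α β) t := by
    refine hasDerivWithinAt_dual_of_apply fun e => ?_
    refine hasDerivWithinAt_of_integral_eq_zero (A := fun τ => D τ (e, 0))
      (B := fun τ => D τ (0, e)) hαβ (hD.clm_apply continuousOn_const)
      (hD.clm_apply continuousOn_const) (fun η θ hθ hη hη0 => ?_) t htαβ
    -- The test displacement `η e` vanishes at `a` and `b`, so the end points stay fixed and `P` and
    -- `Q` impose nothing. Since du Bois-Reymond holds on all of `[α, β]`, the times `a` and `b` are
    -- included.
    have hη' : ∀ τ ∉ Icc α β, η τ • e = 0 := fun τ hτ => by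
      rw [hη0 τ fun h => hτ (Ioo_subset_Icc_self h), zero_smul]
    have hη1 : ∀ τ, HasDerivAt (fun τ => η τ • e) (θ τ • e) τ := fun τ => (hη τ).smul_const e
    have hηa : η a • e = 0 := by rw [hη0 a fun h => h.1.not_ge hα, zero_smul]
    have hηb : η b • e = 0 := by rw [hη0 b fun h => h.2.not_ge hβ, zero_smul]
    have h1 := hγ.integral_eq_zero hL hφ hab (θ := fun τ => θ τ • e)
      (hθ.smul continuous_const) hη1 isClosed_Icc hη'
      (fun τ _ hτ => hsub hτ)
      (Filter.Eventually.of_forall fun s => by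
        rw [chartVariation_of_eq_zero (by rw [hηa, smul_zero])]; exact hγ.1.start_mem)
      (Filter.Eventually.of_forall fun s => by
        rw [chartVariation_of_eq_zero (by rw [hηb, smul_zero])]; exact hγ.1.end_mem)
    rw [integral_eq_integral_of_eq_zero hα hαβ.le hβ fun τ _ hτ => ?_] at h1
    · rw [← h1]
      refine intervalIntegral.integral_congr fun τ _ => ?_
      change D τ (e, 0) * η τ + D τ (0, e) * θ τ = D τ (η τ • e, θ τ • e)
      rw [mul_comm, mul_comm (D τ (0, e)), ← smul_eq_mul, ← smul_eq_mul, ← map_smul, ← map_smul,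
        ← map_add]
      simp
    · have h2 : θ τ • e = 0 := (hη1 τ).unique ((hasDerivAt_const τ (0 : E)).congr_of_eventuallyEq
        (Filter.eventually_of_mem (isClosed_Icc.isOpen_compl.mem_nhds hτ) hη'))
      rw [hη' τ hτ, h2]
      exact map_zero _
  refine (hmain.mono_of_mem_nhdsWithin hnhds).congr_of_eventuallyEq ?_
    (hγ.1.cotangentCoord_FL hL hφ ht hsrc)
  filter_upwards [hnhds] with τ hτ
  exact hγ.1.cotangentCoord_FL hL hφ (hsub' hτ).1 (hsub' hτ).2

/-- The boundary terms in the first variation of a critical point. -/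
theorem IsCriticalPoint.boundary_eq [FiniteDimensional ℝ E] (hL : IsLagrangian U L)
    (hφ : φ ∈ IsManifold.maximalAtlas 𝓘(ℝ, E) ∞ M) (hab : a < b)
    (hγ : IsCriticalPoint U L P Q a b γ) (hθ : Continuous θ) (hη : ∀ t, HasDerivAt η (θ t) t)
    (hK : IsClosed K) (hηK : ∀ t ∉ K, η t = 0) {α β : ℝ} (hα : a ≤ α) (hαβ : α ≤ β) (hβ : β ≤ b)
    (hαβφ : Icc α β ⊆ γ ⁻¹' φ.source) (hKαβ : ∀ t ∈ Icc a b, t ∈ K → t ∈ Icc α β)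
    (hP : ∀ᶠ s in 𝓝 0, chartVariation φ γ η s a ∈ P)
    (hQ : ∀ᶠ s in 𝓝 0, chartVariation φ γ η s b ∈ Q) :
    (cotangentCoord φ (FL L α (velocity a b γ α))).2 (η α) =
      (cotangentCoord φ (FL L β (velocity a b γ β))).2 (η β) := by
  have h1 := hγ.integral_eq_zero hL hφ hab hθ hη hK hηK (fun t ht htK => hαβφ (hKαβ t ht htK)) hP hQ
  rw [integral_eq_integral_of_eq_zero hα hαβ hβ fun τ hτ hταβ => ?_] at h1
  · have hsub : Icc α β ⊆ Icc a b := Icc_subset_Icc hα hβ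
    have hηc : Continuous η := continuous_iff_continuousAt.2 fun t => (hη t).continuousAt
    -- By the Euler-Lagrange equation the integrand of the weak form is the derivative of `p(η)`, so
    -- its vanishing integral equates the values at `α` and `β`.
    have hd : ∀ t ∈ Icc α β, HasDerivWithinAt
        (fun τ => (cotangentCoord φ (FL L τ (velocity a b γ τ))).2 (η τ))
        (fderiv ℝ (coordLagrangian φ L t) (tangentCoord φ (velocity a b γ t)) (η t, θ t))
        (Icc α β) t := by
      intro t ht
      refine ((hγ.eulerLagrangeAt hL hab hφ (hsub ht) (hαβφ ht)).mono hsub).clm_apply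
        (hη t).hasDerivWithinAt |>.congr_deriv ?_
      rw [hγ.1.cotangentCoord_FL hL hφ (hsub ht) (hαβφ ht)]
      simp only [ContinuousLinearMap.comp_apply, ContinuousLinearMap.inl_apply,
        ContinuousLinearMap.inr_apply]
      rw [← map_add]
      simp
    have h2 := intervalIntegral.integral_eq_sub_of_hasDerivAt_of_le hαβ
      (fun t ht => (hd t ht).continuousWithinAt)
      (fun t ht => (hd t (Ioo_subset_Icc_self ht)).hasDerivAt (Icc_mem_nhds ht.1 ht.2)) ?_
    · rw [h1] at h2
      exact (sub_eq_zero.1 h2.symm).symm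
    · refine ContinuousOn.intervalIntegrable ?_
      rw [uIcc_of_le hαβ]
      exact ((hγ.1.continuousOn_fderiv_coordLagrangian hL hab hφ).mono
        fun t ht => ⟨hsub ht, hαβφ ht⟩).clm_apply (hηc.prodMk hθ).continuousOn
  · have hτK : τ ∉ K := fun h => hταβ (hKαβ τ hτ h)
    have h2 : θ τ = 0 := (hη τ).unique ((hasDerivAt_const τ (0 : E)).congr_of_eventuallyEq
      (Filter.eventually_of_mem (hK.isOpen_compl.mem_nhds hτK) hηK))
    rw [hηK τ hτK, h2]
    exact map_zero _

/-- The quotient `(t - x) / (y - x)` allows either order of `x` and `y`, so the same cutoff serves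
the initial and the final point. -/
theorem exists_cutoff {x y : ℝ} (hxy : x ≠ y) : ∃ η θ : ℝ → ℝ, Continuous θ ∧
    (∀ t, HasDerivAt η (θ t) t) ∧ η y = 1 ∧ ∀ t, (t - x) / (y - x) ≤ 0 → η t = 0 := by
  have h : ContDiff ℝ 1 fun t => Real.smoothTransition ((t - x) / (y - x)) :=
    Real.smoothTransition.contDiff.comp (by fun_prop)
  refine ⟨_, _, h.continuous_deriv le_rfl,
    fun t => (h.differentiable (by simp) t).hasDerivAt, ?_, fun t ht => ?_⟩
  · simp [div_self (sub_ne_zero.2 hxy.symm)]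
  · exact Real.smoothTransition.zero_of_nonpos ht

/-- In an adapted chart `P` is a piece of an affine subspace, and displacing along its direction `F`
stays in it; `s` is small only to remain in the chart. -/
theorem eventually_chartVariation_mem {F : Submodule ℝ E} {t : ℝ} (hsrc : γ t ∈ φ.source)
    (hF : ∀ y ∈ φ.source, y ∈ P ↔ φ y - φ (γ t) ∈ F) (hη : η t ∈ F) :
    ∀ᶠ s in 𝓝 (0 : ℝ), chartVariation φ γ η s t ∈ P := by
  have h1 : ContinuousAt (fun s : ℝ => φ (γ t) + s • η t) 0 := by fun_prop
  have h2 := h1.preimage_mem_nhds (t := φ.target) (φ.open_target.mem_nhds (by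
    rw [zero_smul, add_zero]; exact φ.map_source hsrc))
  filter_upwards [h2] with s hs
  rw [chartVariation_of_mem hsrc, hF _ (φ.map_target hs), φ.right_inv hs, add_sub_cancel_left]
  exact F.smul_mem s hη

/-- The difference quotients at `0` of `φ ∘ c`, for a curve `c` in `P`, lie in `F`, which is closed
in finite dimension. -/
theorem IsTangentTo.mfderiv_mem [FiniteDimensional ℝ E] {x : M}
    {v : TangentSpace 𝓘(ℝ, E) x} (hv : IsTangentTo P x v)
    (hφ : φ ∈ IsManifold.maximalAtlas 𝓘(ℝ, E) ∞ M) (hx : x ∈ φ.source) {F : Submodule ℝ E}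
    (hF : ∀ y ∈ φ.source, y ∈ P ↔ φ y - φ x ∈ F) :
    (mfderiv 𝓘(ℝ, E) 𝓘(ℝ, E) φ x v : E) ∈ F := by
  obtain ⟨c, rfl, hcP, hc, rfl⟩ := hv
  have h1 := ((mdifferentiable_of_mem_maximalAtlas hφ).mdifferentiableAt hx).hasMFDerivAt.comp 0
    (hc.mdifferentiableAt (by simp)).hasMFDerivAt
  have h2 : ∀ (A : E →L[ℝ] E) (B : ℝ →L[ℝ] E), HasFDerivAt (φ ∘ c) (A.comp B) 0 →
    HasDerivAt (φ ∘ c) (A (B 1)) 0 := fun A B h => h.hasDerivAt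
  have h3 := h2 _ _ (hasMFDerivAt_iff_hasFDerivAt.1 h1)
  refine (Submodule.closed_of_finiteDimensional F).mem_of_tendsto
    (hasDerivAt_iff_tendsto_slope.1 h3) ?_
  have h4 : ∀ᶠ s in 𝓝 (0 : ℝ), c s ∈ φ.source :=
    hc.continuousAt.preimage_mem_nhds (φ.open_source.mem_nhds hx)
  filter_upwards [(hcP.and h4).filter_mono nhdsWithin_le_nhds] with s hs
  exact F.smul_mem _ ((hF _ hs.2).1 hs.1)

theorem annihilates_of_cotangentCoord [FiniteDimensional ℝ E] {p : CotangentBundle 𝓘(ℝ, E) M}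
    (hφ : φ ∈ IsManifold.maximalAtlas 𝓘(ℝ, E) ∞ M) (hp : p.proj ∈ φ.source) {F : Submodule ℝ E}
    (hF : ∀ y ∈ φ.source, y ∈ P ↔ φ y - φ p.proj ∈ F) (h : ∀ f ∈ F, (cotangentCoord φ p).2 f = 0) :
    Annihilates p P := by
  intro v hv
  have h2 := DFunLike.congr_fun ((mdifferentiable_of_mem_maximalAtlas hφ).symm_comp_deriv hp) v
  exact (congrArg (p.2 : E →L[ℝ] ℝ) h2).symm.trans (h _ (hv.mfderiv_mem hφ hp hF))

/-- For `f ∈ F` the displacement is `f` at time `a` and zero from `β` on, so it moves the initial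
point inside `P` and leaves the final one fixed. The boundary terms then read `p(a) f = 0`. -/
theorem IsCriticalPoint.annihilates_start [FiniteDimensional ℝ E] (hL : IsLagrangian U L)
    (hP : IsEmbeddedSubmanifold (E := E) P) (hab : a < b) (hγ : IsCriticalPoint U L P Q a b γ) :
    Annihilates (FL L a (velocity a b γ a)) P := by
  obtain ⟨φ, hφ, hsrc, F, hF⟩ := hP (γ a) hγ.1.start_mem
  have ha := left_mem_Icc.2 hab.le
  refine annihilates_of_cotangentCoord hφ hsrc hF fun f hf => ?_
  obtain ⟨α, β, hα, hαβ, hβ, haαβ, hsub, -⟩ := exists_Icc_subset_of_mem_nhdsWithin hab ha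
    ((hγ.1.contMDiffOn.continuousOn a ha).preimage_mem_nhdsWithin (φ.open_source.mem_nhds hsrc))
  obtain rfl : α = a := le_antisymm haαβ.1 hα
  obtain ⟨η, θ, hθ, hη, hη1, hη0⟩ := exists_cutoff hαβ.ne'
  have hβ0 : ∀ t, β ≤ t → η t • f = 0 := fun t ht => by
    rw [hη0 t (div_nonpos_of_nonneg_of_nonpos (by linarith) (by linarith)), zero_smul]
  have h := hγ.boundary_eq hL hφ hab (hθ.smul (continuous_const (y := f)))
    (fun t => (hη t).smul_const f) (isClosed_Iic (a := β))
    (fun t ht => hβ0 t (not_le.1 ht).le) le_rfl hαβ.le hβ hsub (fun t ht htβ => ⟨ht.1, htβ⟩)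
    (eventually_chartVariation_mem hsrc hF (F.smul_mem _ hf))
    (Filter.Eventually.of_forall fun s => by
      rw [chartVariation_of_eq_zero (by rw [hβ0 b hβ, smul_zero])]; exact hγ.1.end_mem)
  rw [hη1, one_smul, hβ0 β le_rfl] at h
  exact h.trans (map_zero _)

theorem IsCriticalPoint.annihilates_end [FiniteDimensional ℝ E] (hL : IsLagrangian U L)
    (hQ : IsEmbeddedSubmanifold (E := E) Q) (hab : a < b) (hγ : IsCriticalPoint U L P Q a b γ) :
    Annihilates (FL L b (velocity a b γ b)) Q := by
  obtain ⟨φ, hφ, hsrc, F, hF⟩ := hQ (γ b) hγ.1.end_mem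
  have hb := right_mem_Icc.2 hab.le
  refine annihilates_of_cotangentCoord hφ hsrc hF fun f hf => ?_
  obtain ⟨α, β, hα, hαβ, hβ, hbαβ, hsub, -⟩ := exists_Icc_subset_of_mem_nhdsWithin hab hb
    ((hγ.1.contMDiffOn.continuousOn b hb).preimage_mem_nhdsWithin (φ.open_source.mem_nhds hsrc))
  obtain rfl : β = b := le_antisymm hβ hbαβ.2
  obtain ⟨η, θ, hθ, hη, hη1, hη0⟩ := exists_cutoff hαβ.ne
  have hα0 : ∀ t, t ≤ α → η t • f = 0 := fun t ht => by
    rw [hη0 t (div_nonpos_of_nonpos_of_nonneg (by linarith) (by linarith)), zero_smul]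
  have h := hγ.boundary_eq hL hφ hab (hθ.smul (continuous_const (y := f)))
    (fun t => (hη t).smul_const f) (isClosed_Ici (a := α))
    (fun t ht => hα0 t (not_le.1 ht).le) hα hαβ.le le_rfl hsub (fun t ht htα => ⟨htα, ht.2⟩)
    (Filter.Eventually.of_forall fun s => by
      rw [chartVariation_of_eq_zero (by rw [hα0 a hα, smul_zero])]; exact hγ.1.start_mem)
    (eventually_chartVariation_mem hsrc hF (F.smul_mem _ hf))
  rw [hη1, one_smul, hα0 α le_rfl] at h
  exact h.symm.trans (map_zero _)

end

end LagrangeHamilton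

end

theorem theorem2p8 {E : Type*} [NormedAddCommGroup E] [NormedSpace ℝ E] [FiniteDimensional ℝ E]
    {M : Type*} [TopologicalSpace M] [T2Space M] [SecondCountableTopology M]
    [ChartedSpace E M] [IsManifold 𝓘(ℝ, E) ∞ M]
    (U : Set (ℝ × TangentBundle 𝓘(ℝ, E) M)) (L : ℝ × TangentBundle 𝓘(ℝ, E) M → ℝ)
    (hL : LagrangeHamilton.IsLagrangian U L) (hreg : LagrangeHamilton.IsHyperRegular U L)
    (P Q : Set M) (hP : LagrangeHamilton.IsEmbeddedSubmanifold (E := E) P)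
    (hQ : LagrangeHamilton.IsEmbeddedSubmanifold (E := E) Q)
    (a b : ℝ) (hab : a < b) (γ : ℝ → M) (hγ : LagrangeHamilton.IsAdmissible U P Q a b γ) :
    LagrangeHamilton.IsCriticalPoint U L P Q a b γ ↔
      ∃ Γ : ℝ → LagrangeHamilton.CotangentBundle 𝓘(ℝ, E) M,
        LagrangeHamilton.IsHamiltonianLift (LagrangeHamilton.imageFL U L)
          (LagrangeHamilton.legendre U L) a b γ Γ ∧
        LagrangeHamilton.Annihilates (Γ a) P ∧ LagrangeHamilton.Annihilates (Γ b) Q := by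
  refine ⟨fun h => ?_, fun ⟨Γ, hΓ, h1, h2⟩ => hΓ.isCriticalPoint hL hreg hab hγ h1 h2⟩
  exact ⟨fun t => LagrangeHamilton.FL L t (LagrangeHamilton.velocity a b γ t),
    LagrangeHamilton.isHamiltonianLift_of_eulerLagrange hL hreg hab hγ
      fun _ hφ _ ht hsrc => h.eulerLagrangeAt hL hab hφ ht hsrc,
    h.annihilates_start hL hP hab, h.annihilates_end hL hQ hab⟩
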